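/- Let $[n]=\{1,\dots,n\}$. For a probability distribution $p$ on $[n]$, a nonempty interval $[a,b]\subseteq[2,n-1]$ is a max-interval (resp. min-interval) of $p$ if $p$ equals a constant $c$ on $[a,b]$ and $\max\{p(a-1),p(b+1)\}<c$ (resp. $\min\{p(a-1),p(b+1)\}>c$). Call $p$ $k$-modal if its max-intervals and min-intervals number at most $k$ in total. Let $d_{\mathrm{TV}}(p,q)=\frac12\sum_{i\in[n]}|p(i)-q(i)|$. There is an absolute constant $C>0$ such that the following holds for all integers $n\ge 2$, $k\ge 1$ and all reals $\varepsilon\in(0,1]$, $\delta\in(0,1)$. (1) (Identity testing, $q$ known.) There is a (possibly randomized) tester which, given an explicit $k$-modal distribution $q$ on $[n]$ and $m$ independent samples from a $k$-modal distribution $p$ on $[n]$, where $$m\le C\left(\frac{k^2}{\varepsilon^4}+\frac{(k\log n)^{1/2}}{\varepsilon^3}\log\frac{k\log n}{\varepsilon}\right)\log\frac1\delta$$ depends only on $n,k,\varepsilon,\delta$, accepts with probability at least $1-\delta$ if $p=q$, and rejects with probability at least $1-\delta$ if $d_{\mathrm{TV}}(p,q)\ge\varepsilon$. (2) (Identity testing,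 $q$ unknown.) There is a (possibly randomized) tester which, given $m$ independent samples from each of two $k$-modal distributions $p,q$ on $[n]$, where $$m\le C\left(\frac{k^2}{\varepsilon^4}+\frac{(k\log n)^{2/3}}{\varepsilon^{10/3}}\log\frac{k\log n}{\varepsilon}\right)\log\frac1\delta$$ depends only on $n,k,\varepsilon,\delta$, accepts with probability at least $1-\delta$ if $p=q$, and rejects with probability at least $1-\delta$ if $d_{\mathrm{TV}}(p,q)\ge\varepsilon$. Here $\log$ is the natural logarithm. -/

import Mathlib

/-- A probability distribution over an `n`-element ordered domain: a vector of nonnegative reals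
summing to one. The point `i : Fin n` stands for the element `i + 1` of `{1, …, n}`. -/
abbrev ProbDist (n : ℕ) : Type := stdSimplex ℝ (Fin n)

/-- The interval `[a, b]` is nonempty, contains neither the first nor the last point of the domain,
`f` is constant on it, and both neighbouring values of `f` are strictly smaller. Here `u = a - 1`
and `v = b + 1` are the two neighbours; their existence says that `[a, b]` avoids the endpoints. -/
def IsMaxInterval {n : ℕ} (f : Fin n → ℝ) (a b : Fin n) : Prop :=
  a ≤ b ∧ ∃ c : ℝ, (∀ i, a ≤ i → i ≤ b → f i = c) ∧
    ∃ u v : Fin n, (u : ℕ) + 1 = a ∧ (b : ℕ) + 1 = v ∧ max (f u) (f v) < c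

/-- As `IsMaxInterval`, with both neighbouring values strictly larger. -/
def IsMinInterval {n : ℕ} (f : Fin n → ℝ) (a b : Fin n) : Prop :=
  a ≤ b ∧ ∃ c : ℝ, (∀ i, a ≤ i → i ≤ b → f i = c) ∧
    ∃ u v : Fin n, (u : ℕ) + 1 = a ∧ (b : ℕ) + 1 = v ∧ c < min (f u) (f v)

/-- `p` is `k`-modal: its max-intervals and min-intervals number at most `k` in total. -/
def IsKModal {n : ℕ} (k : ℕ) (p : ProbDist n) : Prop :=
  {I : Fin n × Fin n | IsMaxInterval p.1 I.1 I.2 ∨ IsMinInterval p.1 I.1 I.2}.ncard ≤ k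

/-- Total variation distance, `(1/2) ∑ |p i - q i|`. -/
noncomputable def tvDist {n : ℕ} (p q : ProbDist n) : ℝ :=
  (1 / 2) * ∑ i, |p.1 i - q.1 i|

/-- The probability that `m` independent draws from `p` are, in order, `s 0, …, s (m - 1)`. -/
noncomputable def sampleProb {n m : ℕ} (p : ProbDist n) (s : Fin m → Fin n) : ℝ :=
  ∏ i, p.1 (s i)

/-- A (possibly randomized) tester that is given an explicit distribution `q` and `m` samples from
another distribution. Its value is the probability, over its internal randomness, that it accepts;
otherwise it rejects. -/
abbrev KnownTester (n m : ℕ) : Type :=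
  ProbDist n → (Fin m → Fin n) → unitInterval

/-- A (possibly randomized) tester that is given `m` samples from each of two distributions. Its
value is the probability, over its internal randomness, that it accepts; otherwise it rejects. -/
abbrev UnknownTester (n m : ℕ) : Type :=
  (Fin m → Fin n) → (Fin m → Fin n) → unitInterval

/-- The probability that `T`, given `q` and `m` independent samples from `p`, accepts. -/
noncomputable def KnownTester.acceptProb {n m : ℕ} (T : KnownTester n m)
    (p q : ProbDist n) : ℝ :=
  ∑ s : Fin m → Fin n, sampleProb p s * (T q s : ℝ)

/-- The probability that `T`, given `q` and `m` independent samples from `p`, rejects. -/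
noncomputable def KnownTester.rejectProb {n m : ℕ} (T : KnownTester n m)
    (p q : ProbDist n) : ℝ :=
  ∑ s : Fin m → Fin n, sampleProb p s * (1 - (T q s : ℝ))

/-- The probability that `T` accepts, when its samples are `m` draws from `p` and `m` draws from
`q`, all independent. -/
noncomputable def UnknownTester.acceptProb {n m : ℕ} (T : UnknownTester n m)
    (p q : ProbDist n) : ℝ :=
  ∑ s : Fin m → Fin n, ∑ t : Fin m → Fin n, sampleProb p s * sampleProb q t * (T s t : ℝ)

/-- The probability that `T` rejects, when its samples are `m` draws from `p` and `m` draws from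
`q`, all independent. -/
noncomputable def UnknownTester.rejectProb {n m : ℕ} (T : UnknownTester n m)
    (p q : ProbDist n) : ℝ :=
  ∑ s : Fin m → Fin n, ∑ t : Fin m → Fin n, sampleProb p s * sampleProb q t * (1 - (T s t : ℝ))

/-! The tester reduces the problem to comparing two distributions on a small random partition, and
then compares bin masses by a weighted collision statistic.

Partition. Draw `s` of order `k / ε` points from `q`. They cut the domain into gaps, and each gap is
cut into bins whose lengths grow geometrically, with ratio about `1 + ε / 16`, away from both ends.
This gives `N` bins, where `N` is of order `k log n / ε ^ 2`. A `k`-modal distribution is monotone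
on every interval that avoids some `k` points (`IsKModal.exists_modes`), so only gaps meeting at
most `2 * k` points can be bad for `p` or `q`. A given point lies in a gap of expected `q`-mass at
most `2 / (s + 1)` (`iidExp_mass_gap_le`), so the bad gaps carry little `q`-mass. On a good gap,
replacing a monotone function by its bin averages costs `O(ε)` times its mass
(`sum_abs_sub_average_le_of_antitoneOn`). Growth from both ends serves increasing and decreasing
functions alike. Hence, if `p` and `q` are `ε`-far, their bin masses differ by at least `ε / 2` in
`ℓ¹` for most `S` (`sum_abs_sub_le_of_partition`).

Statistic. Write `Δ I` for the difference of the masses of `I`. Pairs drawn from `p × q` give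
unbiased estimates of the vector `Δ`, and summing a kernel over two independent batches of `m` pairs
estimates `m ^ 2 * ∑ I, w I * Δ I ^ 2`. The weight `w I` is the inverse of one plus the number of
hits of `I` among `a` further draws from `q`. It plays the role of splitting heavy bins: the
weighted collision probability drops to `1 / (a + 1)` on average (`iidExp_sum_sq_binWeight_le`),
while the effective number of bins grows only to `N + a` (`sq_sum_abs_le_binWeight`). By
Cauchy-Schwarz and Chebyshev, `m` of order `(N + a) / (ε ^ 2 * √a)` separates the two cases.

Sample sizes. If `q` is known, all draws from `q` can be averaged over at no cost; `a = N` leaves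
about `√N / ε ^ 2` draws from `p`. If `q` is unknown, `a` is of order `N ^ (2 / 3)` and `m` of order
`N ^ (2 / 3) / ε ^ 2`. A majority vote over `O(log (1 / δ))` blocks brings the error down to `δ`. -/

/-! ### Expectations over independent draws from a finite distribution -/

/-- The expectation of `f` under independent draws, indexed by `ι`, from the weights `w`. -/
noncomputable def iidExp {ι α : Type*} [Fintype ι] [DecidableEq ι] [Fintype α] (w : α → ℝ)
    (f : (ι → α) → ℝ) : ℝ :=
  ∑ s : ι → α, (∏ i, w (s i)) * f s

section iidExp

variable {ι κ α β : Type*} [Fintype ι] [DecidableEq ι] [Fintype κ] [DecidableEq κ]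
  [Fintype α] [Fintype β]

/-- Independence. The one- and two-coordinate formulas below follow by making `g` trivial at the
other coordinates. -/
lemma iidExp_prod (w : α → ℝ) (g : ι → α → ℝ) :
    iidExp w (fun s : ι → α => ∏ i, g i (s i)) = ∏ i, ∑ x, w x * g i x := by
  simp only [iidExp, ← Finset.prod_mul_distrib]
  rw [Finset.prod_univ_sum, Fintype.piFinset_univ]

lemma iidExp_add (w : α → ℝ) (f g : (ι → α) → ℝ) :
    iidExp w (fun s => f s + g s) = iidExp w f + iidExp w g := by
  simp [iidExp, mul_add, Finset.sum_add_distrib]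

lemma iidExp_sub (w : α → ℝ) (f g : (ι → α) → ℝ) :
    iidExp w (fun s => f s - g s) = iidExp w f - iidExp w g := by
  simp [iidExp, mul_sub, Finset.sum_sub_distrib]

lemma iidExp_mul_left (w : α → ℝ) (c : ℝ) (f : (ι → α) → ℝ) :
    iidExp w (fun s => c * f s) = c * iidExp w f := by
  simp only [iidExp, Finset.mul_sum]
  exact Finset.sum_congr rfl fun _ _ => by ring

lemma iidExp_sum {σ : Type*} (w : α → ℝ) (t : Finset σ) (f : σ → (ι → α) → ℝ) :
    iidExp w (fun s => ∑ a ∈ t, f a s) = ∑ a ∈ t, iidExp w (f a) := by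
  simp only [iidExp, Finset.mul_sum]
  exact Finset.sum_comm

lemma iidExp_comm {w : α → ℝ} {v : β → ℝ} (f : (ι → α) → (κ → β) → ℝ) :
    iidExp w (fun s => iidExp v fun t => f s t) = iidExp v fun t => iidExp w fun s => f s t := by
  simp only [iidExp, Finset.mul_sum]
  rw [Finset.sum_comm]
  exact Finset.sum_congr rfl fun _ _ => Finset.sum_congr rfl fun _ _ => by ring

lemma iidExp_mono {w : α → ℝ} (hw : ∀ x, 0 ≤ w x) {f g : (ι → α) → ℝ} (h : ∀ s, f s ≤ g s) :
    iidExp w f ≤ iidExp w g :=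
  Finset.sum_le_sum fun s _ =>
    mul_le_mul_of_nonneg_left (h s) (Finset.prod_nonneg fun _ _ => hw _)

lemma iidExp_nonneg {w : α → ℝ} (hw : ∀ x, 0 ≤ w x) {f : (ι → α) → ℝ} (h : ∀ s, 0 ≤ f s) :
    0 ≤ iidExp w f :=
  Finset.sum_nonneg fun s _ => mul_nonneg (Finset.prod_nonneg fun _ _ => hw _) (h s)

lemma iidExp_const {w : α → ℝ} (hw : w ∈ stdSimplex ℝ α) (c : ℝ) :
    iidExp w (fun _ : ι → α => c) = c := by
  have h := iidExp_prod w (fun (_ : ι) (_ : α) => (1 : ℝ))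
  simp only [Finset.prod_const_one, mul_one, hw.2] at h
  simpa [h] using iidExp_mul_left w c (fun _ : ι → α => (1 : ℝ))

lemma iidWeight_mem_stdSimplex {w : α → ℝ} (hw : w ∈ stdSimplex ℝ α) :
    (fun s : ι → α => ∏ i, w (s i)) ∈ stdSimplex ℝ (ι → α) :=
  ⟨fun _ => Finset.prod_nonneg fun _ _ => hw.1 _, by
    simpa [iidExp] using iidExp_const (ι := ι) hw 1⟩

lemma iidExp_apply {w : α → ℝ} (hw : w ∈ stdSimplex ℝ α) (i : ι) (g : α → ℝ) :
    iidExp w (fun s : ι → α => g (s i)) = ∑ x, w x * g x := by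
  have h := iidExp_prod w (fun (j : ι) (x : α) => if j = i then g x else 1)
  simp only [Finset.prod_ite_eq', Finset.mem_univ, if_true] at h
  rw [h, Finset.prod_eq_single i]
  · simp
  · intro j _ hj
    simp [hj, hw.2]
  · simp

lemma iidExp_apply_mul_apply {w : α → ℝ} (hw : w ∈ stdSimplex ℝ α) {i j : ι} (hij : i ≠ j)
    (g h : α → ℝ) :
    iidExp w (fun s : ι → α => g (s i) * h (s j)) = (∑ x, w x * g x) * ∑ x, w x * h x := by
  have e := iidExp_prod w
    (fun (l : ι) (x : α) => (if l = i then g x else 1) * if l = j then h x else 1)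
  simp only [Finset.prod_mul_distrib, Finset.prod_ite_eq', Finset.mem_univ, if_true] at e
  rw [e, ← Finset.mul_prod_erase _ _ (Finset.mem_univ i),
    ← Finset.mul_prod_erase _ _ (Finset.mem_erase.2 ⟨hij.symm, Finset.mem_univ j⟩),
    Finset.prod_eq_one]
  · simp [hij, hij.symm]
  · intro l hl
    simp only [Finset.mem_erase] at hl
    simp [hl.1, hl.2.1, hw.2]

/-- The second moment of a sum of independent copies of `g`. -/
lemma iidExp_sq_sum_le {w : α → ℝ} (hw : w ∈ stdSimplex ℝ α) (g : α → ℝ) :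
    iidExp w (fun s : ι → α => (∑ i, g (s i)) ^ 2) ≤
      Fintype.card ι * (∑ x, w x * g x ^ 2) + (Fintype.card ι * ∑ x, w x * g x) ^ 2 := by
  have h1 : ∀ s : ι → α, (∑ i, g (s i)) ^ 2 = ∑ i, ∑ j, g (s i) * g (s j) := fun s => by
    rw [sq, Finset.sum_mul_sum]
  -- The squared mean is also added on the diagonal, so that the double sum closes up to a full
  -- square.
  have h2 : ∀ i j : ι, iidExp w (fun s : ι → α => g (s i) * g (s j)) ≤
      (if i = j then ∑ x, w x * g x ^ 2 else 0) + (∑ x, w x * g x) ^ 2 := by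
    intro i j
    by_cases hij : i = j
    · subst hij
      have h := iidExp_apply hw i (fun x => g x ^ 2)
      simp only [← sq, if_true]
      rw [h]
      nlinarith [sq_nonneg (∑ x, w x * g x)]
    · rw [iidExp_apply_mul_apply hw hij, if_neg hij, zero_add, sq]
  simp only [h1, iidExp_sum]
  refine (Finset.sum_le_sum fun i _ => Finset.sum_le_sum fun j _ => h2 i j).trans (le_of_eq ?_)
  simp [Finset.sum_add_distrib]
  ring

lemma iidExp_sum_apply {w : α → ℝ} (hw : w ∈ stdSimplex ℝ α) (g : α → ℝ) :
    iidExp w (fun s : ι → α => ∑ i, g (s i)) = Fintype.card ι * ∑ x, w x * g x := by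
  simp [iidExp_sum, iidExp_apply hw]

lemma iidExp_reindex (e : ι ≃ κ) (w : α → ℝ) (f : (ι → α) → ℝ) :
    iidExp w (fun s : κ → α => f (s ∘ e)) = iidExp w f := by
  refine Fintype.sum_equiv (e.symm.arrowCongr (Equiv.refl α)) _ _ fun s => ?_
  have : (e.symm.arrowCongr (Equiv.refl α)) s = s ∘ e := by ext; simp
  rw [this, ← e.prod_comp]
  rfl

lemma iidExp_sumElim (w : α → ℝ) (f : (ι ⊕ κ → α) → ℝ) :
    iidExp w f = iidExp w fun s : ι → α => iidExp w fun t : κ → α => f (Sum.elim s t) := by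
  simp only [iidExp, Finset.mul_sum]
  rw [← Fintype.sum_prod_type']
  refine Fintype.sum_equiv (Equiv.sumArrowEquivProdArrow ι κ α) _ _ fun s => ?_
  have : Sum.elim (s ∘ Sum.inl) (s ∘ Sum.inr) = s := Sum.elim_comp_inl_inr s
  simp only [Fintype.prod_sum_type, Equiv.sumArrowEquivProdArrow, Equiv.coe_fn_mk, this, mul_assoc,
    Function.comp]

lemma iidExp_prodLaw (w : α → ℝ) (v : β → ℝ) (f : (ι → α × β) → ℝ) :
    iidExp (fun z : α × β => w z.1 * v z.2) f =
      iidExp w fun s : ι → α => iidExp v fun t : ι → β => f fun i => (s i, t i) := by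
  simp only [iidExp, Finset.mul_sum]
  rw [← Fintype.sum_prod_type']
  refine Fintype.sum_equiv (Equiv.arrowProdEquivProdArrow ι (fun _ => α) (fun _ => β)) _ _ fun s => ?_
  simp [Finset.prod_mul_distrib, mul_assoc, Equiv.arrowProdEquivProdArrow]

lemma iidExp_blocks (w : α → ℝ) (f : (κ × ι → α) → ℝ) :
    iidExp w f = iidExp (fun b : ι → α => ∏ j, w (b j))
      fun s : κ → ι → α => f fun l => s l.1 l.2 := by
  refine Fintype.sum_equiv (Equiv.curry κ ι α) _ _ fun s => ?_
  rw [Fintype.prod_prod_type]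
  rfl

lemma prodLaw_mem_stdSimplex {w : α → ℝ} {v : β → ℝ} (hw : w ∈ stdSimplex ℝ α)
    (hv : v ∈ stdSimplex ℝ β) : (fun z : α × β => w z.1 * v z.2) ∈ stdSimplex ℝ (α × β) := by
  refine ⟨fun _ => mul_nonneg (hw.1 _) (hv.1 _), ?_⟩
  rw [Fintype.sum_prod_type]
  simp [← Finset.mul_sum, hv.2, hw.2]

end iidExp

/-! ### Amplification by majority vote -/

section majority

variable {ι κ α : Type*} [Fintype ι] [DecidableEq ι] [Fintype κ] [DecidableEq κ] [Fintype α]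

/-- If an event has probability at most `1 / 8`, it is unlikely to occur in half of the trials. -/
lemma iidExp_majority_le {w : α → ℝ} (hw : w ∈ stdSimplex ℝ α) (D : α → Bool)
    (hD : ∑ x, w x * (if D x then 1 else 0) ≤ 1 / 8) :
    iidExp w (fun s : κ → α =>
      if Fintype.card κ ≤ 2 * (Finset.univ.filter fun i => D (s i)).card then 1 else 0)
      ≤ (2 / 3 : ℝ) ^ Fintype.card κ := by
  -- An exponential moment bound: the base `9` contributes `9 ^ (r / 2) = 3 ^ r` on the event,
  -- against a mean of at most `(1 + 8 / 8) ^ r = 2 ^ r`.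
  have h1 : iidExp w (fun s : κ → α => ∏ i, if D (s i) then (9 : ℝ) else 1)
      ≤ 2 ^ Fintype.card κ := by
    rw [iidExp_prod w fun _ x => if D x then (9 : ℝ) else 1, Finset.prod_const, Finset.card_univ]
    have : ∑ x, w x * (if D x then (9 : ℝ) else 1)
        = (∑ x, w x) + 8 * ∑ x, w x * (if D x then 1 else 0) := by
      rw [Finset.mul_sum, ← Finset.sum_add_distrib]
      refine Finset.sum_congr rfl fun x _ => ?_
      split_ifs <;> ring
    rw [this, hw.2]
    have h0 : 0 ≤ ∑ x, w x * (if D x then (1 : ℝ) else 0) :=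
      Finset.sum_nonneg fun x _ => mul_nonneg (hw.1 x) (by split_ifs <;> norm_num)
    exact pow_le_pow_left₀ (by linarith) (by linarith) _
  have h2 : ∀ s : κ → α,
      (if Fintype.card κ ≤ 2 * (Finset.univ.filter fun i => D (s i)).card then (1 : ℝ) else 0) ≤
        (1 / 3 : ℝ) ^ Fintype.card κ * ∏ i, if D (s i) then (9 : ℝ) else 1 := by
    intro s
    rw [Finset.prod_ite, Finset.prod_const_one, mul_one, Finset.prod_const]
    split_ifs with h
    · have : (3 : ℝ) ^ Fintype.card κ ≤ 9 ^ (Finset.univ.filter fun i => D (s i)).card := by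
        rw [show (9 : ℝ) = 3 ^ 2 by norm_num, ← pow_mul]
        exact pow_le_pow_right₀ (by norm_num) h
      rw [one_div, inv_pow, inv_mul_eq_div, le_div_iff₀ (by positivity)]
      simpa using this
    · positivity
  refine (iidExp_mono hw.1 h2).trans ?_
  rw [iidExp_mul_left]
  refine (mul_le_mul_of_nonneg_left h1 (by positivity)).trans (le_of_eq ?_)
  rw [← mul_pow]
  norm_num

/-- Repeating a test on independent blocks of samples and taking a majority vote turns error
probabilities `1 / 8` into `(2 / 3) ^ r`. -/
lemma exists_amplified_test (D : (ι → α) → Bool) (r : ℕ) :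
    ∃ D' : (Fin (r * Fintype.card ι) → α) → Bool, ∀ w ∈ stdSimplex ℝ α,
      (iidExp w (fun s : ι → α => if D s then 1 else 0) ≤ 1 / 8 →
        iidExp w (fun s => if D' s then 1 else 0) ≤ (2 / 3 : ℝ) ^ r) ∧
      (iidExp w (fun s : ι → α => if D s then 0 else 1) ≤ 1 / 8 →
        iidExp w (fun s => if D' s then 0 else 1) ≤ (2 / 3 : ℝ) ^ r) := by
  have hc : Fintype.card (Fin r × ι) = Fintype.card (Fin (r * Fintype.card ι)) := by simp
  let e : Fin r × ι ≃ Fin (r * Fintype.card ι) := Fintype.equivOfCardEq hc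
  let E : (Fin r × ι → α) → Bool := fun s =>
    decide (r ≤ 2 * (Finset.univ.filter fun i : Fin r => D fun j => s (i, j)).card)
  refine ⟨fun s => E (s ∘ e), fun w hw => ⟨fun h => ?_, fun h => ?_⟩⟩
  · change iidExp w (fun s => if E (s ∘ e) then 1 else 0) ≤ _
    rw [iidExp_reindex e w fun s => if E s then 1 else 0, iidExp_blocks]
    have := iidExp_majority_le (κ := Fin r) (iidWeight_mem_stdSimplex (ι := ι) hw) D h
    simpa [E] using this
  · change iidExp w (fun s => if E (s ∘ e) then 0 else 1) ≤ _
    rw [iidExp_reindex e w fun s => if E s then 0 else 1, iidExp_blocks]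
    have h' : ∑ x : ι → α, (∏ i, w (x i)) * (if !D x then 1 else 0) ≤ (1 / 8 : ℝ) := by
      refine le_trans (le_of_eq ?_) h
      exact Finset.sum_congr rfl fun x _ => by cases h : D x <;> simp [h]
    have := iidExp_majority_le (κ := Fin r) (iidWeight_mem_stdSimplex (ι := ι) hw)
      (fun s => !D s) h'
    rw [Fintype.card_fin] at this
    refine le_trans (iidExp_mono (iidWeight_mem_stdSimplex hw).1 fun s => ?_) this
    -- Ties are accepted, so rejection means strictly more than half negative votes, and the same
    -- tail bound covers both errors.
    have hs := Finset.card_filter_add_card_filter_not (s := (Finset.univ : Finset (Fin r)))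
      (fun i => D (s i) = true)
    rw [Finset.card_univ, Fintype.card_fin] at hs
    have e1 : (E fun l => s l.1 l.2)
        = decide (r ≤ 2 * (Finset.univ.filter fun i => D (s i) = true).card) := rfl
    simp only [e1, decide_eq_true_eq, Bool.not_eq_true', ← Bool.not_eq_true]
    split_ifs with h1 h2
    · norm_num
    · norm_num
    · norm_num
    · omega

end majority

/-! ### Monotone stretches of `k`-modal distributions -/

/-- A strict increase followed by a strict decrease encloses a plateau with lower neighbours. -/
lemma exists_plateau (g : ℕ → ℝ) (i j : ℕ) (hij : i < j) (hi : g i < g (i + 1))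
    (hj : g (j + 1) < g j) :
    ∃ a b, i ≤ a ∧ a < b ∧ b ≤ j ∧ g a < g (a + 1) ∧ g (b + 1) < g b ∧
      ∀ t, a < t → t ≤ b → g t = g b := by
  induction h : j - i using Nat.strong_induction_on generalizing i j with
  | _ d ih =>
    -- A non-flat step strictly between `i` and `j` can replace one of the two ends, according to
    -- its sign. When no such step is left, the stretch is a plateau.
    by_cases hc : ∃ t, i < t ∧ t < j ∧ g t ≠ g (t + 1)
    · obtain ⟨t, hit, htj, ht⟩ := hc
      rcases lt_or_gt_of_ne ht with ht | ht
      · obtain ⟨a, b, h1, h2, h3, h4⟩ := ih (j - t) (by omega) t j htj ht hj rfl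
        exact ⟨a, b, by omega, h2, h3, h4⟩
      · obtain ⟨a, b, h1, h2, h3, h4⟩ := ih (t - i) (by omega) i t hit hi ht rfl
        exact ⟨a, b, h1, h2, by omega, h4⟩
    · push Not at hc
      refine ⟨i, j, le_rfl, hij, le_rfl, hi, hj, fun t hit htj => ?_⟩
      induction htj using Nat.decreasingInduction with
      | of_succ l hl ihl => exact (hc l hit (by omega)).trans (ihl (by omega))
      | self => rfl

lemma exists_isMaxInterval {n : ℕ} {f : Fin n → ℝ} {i i' j j' : Fin n}
    (hi : (i : ℕ) + 1 = i') (hj : (j : ℕ) + 1 = j') (hij : i < j) (h1 : f i < f i')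
    (h2 : f j' < f j) : ∃ a b, i' ≤ a ∧ a ≤ j ∧ IsMaxInterval f a b := by
  let g : ℕ → ℝ := fun t => if h : t < n then f ⟨t, h⟩ else 0
  have hg : ∀ x : Fin n, g x = f x := fun x => by simp [g]
  obtain ⟨a, b, ha, hab, hb, hga, hgb, hc⟩ := exists_plateau g i j hij
    (by rw [hi, hg, hg]; exact h1) (by rw [hj, hg, hg]; exact h2)
  have hjn := j'.2
  refine ⟨⟨a + 1, by omega⟩, ⟨b, by omega⟩, Fin.le_def.2 (by simp; omega),
    Fin.le_def.2 (by simp; omega), Fin.le_def.2 (by simp; omega), g b, fun x h3 h4 => ?_,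
    ⟨a, by omega⟩, ⟨b + 1, by omega⟩, rfl, rfl, ?_⟩
  · rw [← hg]
    exact hc x (Fin.le_def.1 h3) (Fin.le_def.1 h4)
  · rw [← hg, ← hg]
    rw [hc (a + 1) (by omega) (by omega)] at hga
    exact max_lt hga hgb

lemma IsMaxInterval.isMinInterval_of_neg {n : ℕ} {f : Fin n → ℝ} {a b : Fin n}
    (h : IsMaxInterval (-f) a b) : IsMinInterval f a b := by
  obtain ⟨hab, c, hc, u, v, hu, hv, hm⟩ := h
  refine ⟨hab, -c, fun i h1 h2 => by rw [← hc i h1 h2]; simp, u, v, hu, hv, ?_⟩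
  rw [max_lt_iff] at hm
  simp only [Pi.neg_apply] at hm
  exact lt_min (by linarith) (by linarith)

lemma exists_lt_succ_of_lt {n : ℕ} {f : Fin n → ℝ} {x y : Fin n} (hxy : x ≤ y) (h : f x < f y) :
    ∃ t t' : Fin n, (t : ℕ) + 1 = t' ∧ x ≤ t ∧ t' ≤ y ∧ f t < f t' := by
  by_contra! hc
  have : ∀ m : ℕ, (x : ℕ) ≤ m → ∀ hm : m < n, m ≤ y → f ⟨m, hm⟩ ≤ f x := by
    intro m hxm
    induction m, hxm using Nat.le_induction with
    | base => exact fun _ _ => le_rfl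
    | succ m hm ih =>
      intro h1 h2
      exact (hc ⟨m, by omega⟩ ⟨m + 1, h1⟩ rfl (Fin.le_def.2 hm) (Fin.le_def.2 h2)).trans
        (ih (by omega) (by omega))
  exact absurd (this y hxy y.2 le_rfl) (not_le.2 h)

/-- A `k`-modal distribution is monotone on each interval that avoids certain `k` points. -/
lemma IsKModal.exists_modes {n k : ℕ} {p : ProbDist n} (hp : IsKModal k p) :
    ∃ M : Finset (Fin n), M.card ≤ k ∧ ∀ J : Set (Fin n), J.OrdConnected → Disjoint J M →
      MonotoneOn p.1 J ∨ AntitoneOn p.1 J := by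
  classical
  set S := {I : Fin n × Fin n | IsMaxInterval p.1 I.1 I.2 ∨ IsMinInterval p.1 I.1 I.2} with hS
  -- The excluded points are the left ends of the max- and min-intervals. A rise and a fall inside
  -- `J` would enclose such an interval whose left end lies in `J`.
  refine ⟨(Set.toFinite S).toFinset.image Prod.fst, ?_, fun J hJ hd => ?_⟩
  · refine Finset.card_image_le.trans ?_
    rw [← Set.ncard_eq_toFinset_card S]
    exact hp
  · have hM : ∀ a b, a ∈ J → ¬ IsMaxInterval p.1 a b ∧ ¬ IsMinInterval p.1 a b := by
      intro a b ha
      have := Set.disjoint_left.1 hd ha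
      simp only [Finset.coe_image, Set.Finite.coe_toFinset, Set.mem_image, not_exists, not_and] at this
      exact ⟨fun h => this (a, b) (Or.inl h) rfl, fun h => this (a, b) (Or.inr h) rfl⟩
    by_contra! hc
    obtain ⟨hc1, hc2⟩ := hc
    simp only [MonotoneOn, AntitoneOn, not_forall, not_le] at hc1 hc2
    obtain ⟨x, hx, y, hy, hxy, h1⟩ := hc1
    obtain ⟨u, hu, v, hv, huv, h2⟩ := hc2
    obtain ⟨i, i', hi, hui, hiv, hf⟩ := exists_lt_succ_of_lt huv h2
    obtain ⟨j, j', hj, hxj, hjy, hf'⟩ := exists_lt_succ_of_lt (f := -p.1) hxy (by simpa using h1)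
    simp only [Pi.neg_apply, neg_lt_neg_iff] at hf'
    have hiJ : i ∈ J := hJ.out hu hv ⟨hui, le_trans (Fin.le_def.2 (by omega)) hiv⟩
    have hjJ : j ∈ J := hJ.out hx hy ⟨hxj, le_trans (Fin.le_def.2 (by omega)) hjy⟩
    have hiJ' : i' ∈ J := hJ.out hu hv ⟨le_trans hui (Fin.le_def.2 (by omega)), hiv⟩
    have hjJ' : j' ∈ J := hJ.out hx hy ⟨le_trans hxj (Fin.le_def.2 (by omega)), hjy⟩
    rcases lt_trichotomy i j with hij | hij | hij
    · obtain ⟨a, b, ha, hb, hab⟩ := exists_isMaxInterval hi hj hij hf hf'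
      exact (hM a b (hJ.out hiJ' hjJ ⟨ha, hb⟩)).1 hab
    · subst hij
      have : i' = j' := Fin.ext (by omega)
      subst this
      exact lt_asymm hf hf'
    · obtain ⟨a, b, ha, hb, hab⟩ := exists_isMaxInterval (f := -p.1) hj hi hij
        (by simpa using hf') (by simpa using hf)
      exact (hM a b (hJ.out hjJ' hiJ ⟨ha, hb⟩)).2 hab.isMinInterval_of_neg

/-! ### Flattening a monotone function -/

/-- Abel summation: a nonnegative antitone function is a nonnegative combination of indicators of
initial segments. -/
lemma sum_mul_nonneg_of_antitoneOn {α : Type*} [LinearOrder α] (s : Finset α) {f g : α → ℝ}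
    (hf : AntitoneOn f s) (hf0 : ∀ x ∈ s, 0 ≤ f x)
    (hg : ∀ t ∈ s, 0 ≤ ∑ x ∈ s with x ≤ t, g x) : 0 ≤ ∑ x ∈ s, f x * g x := by
  -- The lower bound `c` makes the induction close: when the maximum `a` is removed, `f a` serves as
  -- the bound for the rest.
  have key : ∀ c : ℝ, (∀ x ∈ s, c ≤ f x) → c * ∑ x ∈ s, g x ≤ ∑ x ∈ s, f x * g x := by
    clear hf0
    induction s using Finset.induction_on_max with
    | empty => simp
    | insert a s hs ih =>
      intro c hc
      have ha : a ∉ s := fun h => lt_irrefl a (hs a h)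
      have h1 : 0 ≤ ∑ x ∈ insert a s, g x := by
        convert hg a (Finset.mem_insert_self a s) using 2
        rw [Finset.filter_true_of_mem]
        intro x hx
        rcases Finset.mem_insert.1 hx with rfl | hx
        exacts [le_rfl, (hs x hx).le]
      have h2 : f a * ∑ x ∈ s, g x ≤ ∑ x ∈ s, f x * g x := by
        refine ih (hf.mono (by simp)) (fun t ht => ?_) (f a) fun x hx => ?_
        · convert hg t (Finset.mem_insert_of_mem ht) using 2
          rw [Finset.filter_insert, if_neg (not_le.2 (hs t ht))]
        · exact hf (by simp [hx]) (by simp) (hs x hx).le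
      have h3 := mul_le_mul_of_nonneg_right (hc a (Finset.mem_insert_self a s)) h1
      rw [Finset.sum_insert ha] at h1 h3 ⊢
      rw [Finset.sum_insert ha]
      linarith
  simpa using key 0 hf0

/-- If the part of each bin that lies beyond a point is short compared with the part of `J` up to
that point, then replacing an antitone function by its averages over the bins changes it little. -/
lemma sum_abs_sub_average_le_of_antitoneOn {α Λ : Type*} [LinearOrder α] [DecidableEq Λ]
    (J : Finset α) (c : α → Λ) {f : α → ℝ} {κ : ℝ} (hκ : 0 ≤ κ) (hf : AntitoneOn f J)
    (hf0 : ∀ x ∈ J, 0 ≤ f x)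
    (h : ∀ x ∈ J, ∀ y ∈ J, x < y → c x = c y →
      ((J.filter fun z => x < z ∧ z ≤ y).card : ℝ) ≤ κ * (J.filter fun z => z ≤ x).card) :
    ∑ x ∈ J, |f x - (∑ y ∈ J with c y = c x, f y) / (J.filter fun y => c y = c x).card| ≤
      2 * κ * ∑ x ∈ J, f x := by
  set N : α → ℝ := fun x => (J.filter fun y => c y = c x).card with hN
  have hNpos : ∀ x ∈ J, 0 < N x := fun x hx => by
    simp only [hN, Nat.cast_pos, Finset.card_pos]
    exact ⟨x, by simp [hx]⟩
  -- `K x y` is the sign of `y - x` divided by the bin size, within one bin. Since `f` is antitone,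
  -- `K x y * (f x - f y)` is `|f x - f y|` over the bin size, and antisymmetry turns the double sum
  -- into a pairing of `f` with the row sums of `K`.
  set K : α → α → ℝ := fun x y =>
    if c y = c x then (if x < y then 1 else if y < x then -1 else 0) / N x else 0 with hK
  have hanti : ∀ x y, K y x = - K x y := by
    intro x y
    simp only [hK]
    by_cases hc : c y = c x
    · have : N x = N y := by simp only [hN, hc]
      rcases lt_trichotomy x y with hxy | hxy | hxy
      · simp [hc, hxy, hxy.not_gt, this, neg_div]
      · subst hxy; simp
      · simp [hc, hxy, hxy.not_gt, this, neg_div]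
    · simp [hc, Ne.symm hc]
  have hA : ∀ x ∈ J, |f x - (∑ y ∈ J with c y = c x, f y) / N x| ≤
      ∑ y ∈ J, K x y * (f x - f y) := by
    intro x hx
    have e : f x - (∑ y ∈ J with c y = c x, f y) / N x =
        (∑ y ∈ J with c y = c x, (f x - f y)) / N x := by
      rw [Finset.sum_sub_distrib, Finset.sum_const, nsmul_eq_mul, sub_div,
        mul_div_cancel_left₀ _ (hNpos x hx).ne']
    rw [e, abs_div, abs_of_pos (hNpos x hx), div_le_iff₀ (hNpos x hx)]
    refine (Finset.abs_sum_le_sum_abs _ _).trans (le_of_eq ?_)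
    rw [Finset.sum_filter, Finset.sum_mul]
    refine Finset.sum_congr rfl fun y hy => ?_
    simp only [hK]
    by_cases hc : c y = c x
    · simp only [hc, if_true]
      rw [div_mul_eq_mul_div, div_mul_cancel₀ _ (hNpos x hx).ne']
      rcases lt_trichotomy x y with hxy | hxy | hxy
      · have := hf hx hy hxy.le
        simp [hxy, abs_of_nonneg (sub_nonneg.2 this)]
      · subst hxy; simp
      · have := hf hy hx hxy.le
        simp [hxy, hxy.not_gt, abs_of_nonpos (sub_nonpos.2 this)]
    · simp [hc]
  have hB : ∑ x ∈ J, ∑ y ∈ J, K x y * (f x - f y) = 2 * ∑ x ∈ J, f x * ∑ y ∈ J, K x y := by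
    have e1 : ∑ x ∈ J, ∑ y ∈ J, K x y * f y = - ∑ x ∈ J, ∑ y ∈ J, K x y * f x := by
      rw [Finset.sum_comm, ← Finset.sum_neg_distrib]
      refine Finset.sum_congr rfl fun x _ => ?_
      rw [← Finset.sum_neg_distrib]
      refine Finset.sum_congr rfl fun y _ => ?_
      rw [hanti x y]; ring
    simp only [mul_sub, Finset.sum_sub_distrib, e1]
    rw [sub_neg_eq_add, ← two_mul]
    congr 1
    refine Finset.sum_congr rfl fun x _ => ?_
    rw [Finset.mul_sum]
    exact Finset.sum_congr rfl fun y _ => mul_comm _ _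
  -- In the row sums up to `t`, pairs with both points below `t` cancel by antisymmetry. What
  -- remains are pairs of one bin straddling `t`, and each `y` beyond `t` receives at most `1` in
  -- total.
  have hC : ∀ t ∈ J, ∑ x ∈ J with x ≤ t, ∑ y ∈ J, K x y ≤
      κ * (J.filter fun z => z ≤ t).card := by
    intro t ht
    have e1 : ∑ x ∈ J with x ≤ t, ∑ y ∈ J with y ≤ t, K x y = 0 := by
      have : ∑ x ∈ J with x ≤ t, ∑ y ∈ J with y ≤ t, K x y =
          - ∑ x ∈ J with x ≤ t, ∑ y ∈ J with y ≤ t, K x y := by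
        conv_lhs => rw [Finset.sum_comm]
        simp only [← Finset.sum_neg_distrib]
        exact Finset.sum_congr rfl fun x _ => Finset.sum_congr rfl fun y _ => hanti x y
      linarith
    have e2 : ∑ x ∈ J with x ≤ t, ∑ y ∈ J, K x y =
        ∑ y ∈ J with ¬ y ≤ t, ∑ x ∈ J with x ≤ t, K x y := by
      rw [Finset.sum_comm (s := J.filter fun y => ¬ y ≤ t)]
      have : ∀ x, ∑ y ∈ J, K x y = ∑ y ∈ J with y ≤ t, K x y + ∑ y ∈ J with ¬ y ≤ t, K x y :=
        fun x => (Finset.sum_filter_add_sum_filter_not _ _ _).symm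
      simp only [this, Finset.sum_add_distrib, e1, zero_add]
    set Y := (J.filter fun y => ¬ y ≤ t).filter fun y => ∃ x ∈ J, x ≤ t ∧ c x = c y with hY
    have e3 : ∑ y ∈ J with ¬ y ≤ t, ∑ x ∈ J with x ≤ t, K x y ≤ Y.card := by
      rw [hY, Finset.card_filter, Nat.cast_sum]
      refine Finset.sum_le_sum fun y hy => ?_
      simp only [Finset.mem_filter, not_le] at hy
      split_ifs with hex
      · have : ∑ x ∈ J with x ≤ t, K x y ≤
            ∑ x ∈ J with x ≤ t, if c x = c y then 1 / N y else 0 := by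
          refine Finset.sum_le_sum fun x hx => ?_
          simp only [Finset.mem_filter] at hx
          simp only [hK]
          by_cases hc : c y = c x
          · have hNN : N x = N y := by simp only [hN, hc]
            simp [hc, hx.2.trans_lt hy.2, hNN]
          · simp [hc, Ne.symm hc]
        refine this.trans ?_
        rw [← Finset.sum_filter, Finset.sum_const, nsmul_eq_mul, mul_one_div, Nat.cast_one,
          div_le_one (hNpos y hy.1)]
        simp only [hN, Nat.cast_le]
        refine Finset.card_le_card fun x hx => ?_
        simp only [Finset.mem_filter] at hx ⊢
        exact ⟨hx.1.1, hx.2⟩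
      · rw [Nat.cast_zero]
        refine (Finset.sum_eq_zero fun x hx => ?_).le
        simp only [Finset.mem_filter] at hx
        simp only [hK]
        rw [if_neg]
        exact fun hc => hex ⟨x, hx.1, hx.2, hc.symm⟩
    rw [e2]
    refine e3.trans ?_
    rcases Y.eq_empty_or_nonempty with hE | hE
    · rw [hE, Finset.card_empty]; exact (Nat.cast_zero (R := ℝ)).le.trans (mul_nonneg hκ (Nat.cast_nonneg _))
    -- All of `Y` lies between the bin partner `x ≤ t` of its largest element `y` and `y` itself, so
    -- a single use of `h` bounds its size.
    · obtain ⟨y, hm, hmax⟩ := Y.exists_max_image id hE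
      rw [hY, Finset.mem_filter, Finset.mem_filter, not_le] at hm
      obtain ⟨⟨hyJ, hty⟩, x, hxJ, hxt, hxy⟩ := hm
      refine le_trans ?_ ((h x hxJ y hyJ (hxt.trans_lt hty) hxy).trans
        (mul_le_mul_of_nonneg_left ?_ hκ))
      · rw [Nat.cast_le]
        refine Finset.card_le_card fun z hz => ?_
        have hz' := hmax z hz
        rw [hY, Finset.mem_filter, Finset.mem_filter, not_le] at hz
        simp only [Finset.mem_filter]
        exact ⟨hz.1.1, hxt.trans_lt hz.1.2, hz'⟩
      · rw [Nat.cast_le]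
        refine Finset.card_le_card fun z hz => ?_
        simp only [Finset.mem_filter] at hz ⊢
        exact ⟨hz.1, hz.2.trans hxt⟩
  have hD := sum_mul_nonneg_of_antitoneOn J (g := fun x => κ - ∑ y ∈ J, K x y) hf hf0
    fun t ht => by
      rw [Finset.sum_sub_distrib, Finset.sum_const, nsmul_eq_mul]
      linarith [hC t ht]
  simp only [mul_sub, Finset.sum_sub_distrib, ← Finset.sum_mul] at hD
  calc _ ≤ ∑ x ∈ J, ∑ y ∈ J, K x y * (f x - f y) := Finset.sum_le_sum hA
    _ ≤ _ := by rw [hB]; linarith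

lemma sum_abs_sub_average_le_of_monotoneOn {α Λ : Type*} [LinearOrder α] [DecidableEq Λ]
    (J : Finset α) (c : α → Λ) {f : α → ℝ} {κ : ℝ} (hκ : 0 ≤ κ) (hf : MonotoneOn f J)
    (hf0 : ∀ x ∈ J, 0 ≤ f x)
    (h : ∀ x ∈ J, ∀ y ∈ J, x < y → c x = c y →
      ((J.filter fun z => z < y ∧ x ≤ z).card : ℝ) ≤ κ * (J.filter fun z => y ≤ z).card) :
    ∑ x ∈ J, |f x - (∑ y ∈ J with c y = c x, f y) / (J.filter fun y => c y = c x).card| ≤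
      2 * κ * ∑ x ∈ J, f x :=
  sum_abs_sub_average_le_of_antitoneOn (α := αᵒᵈ) J c hκ
    (fun _ hx _ hy hxy => hf hy hx hxy) hf0 fun x hx y hy hxy hc => h y hy x hx hxy hc.symm

/-! ### The mass of the gap around a point -/

/-- The mean value inequality for the power `s + 1`, with the derivative bounded below at `v`. -/
lemma succ_mul_sub_mul_pow_le {u v : ℝ} (hv : 0 ≤ v) (huv : v ≤ u) (s : ℕ) :
    (s + 1) * ((u - v) * v ^ s) ≤ u ^ (s + 1) - v ^ (s + 1) := by
  induction s with
  | zero => simp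
  | succ s ih =>
    have h1 := mul_le_mul_of_nonneg_left ih (hv.trans huv)
    have h2 : 0 ≤ (u - v) * v ^ s * (u - v) * (s + 1) := by
      have := sub_nonneg.2 huv
      positivity
    push_cast
    have e1 : u ^ (s + 1 + 1) - v ^ (s + 1 + 1) =
      u * (u ^ (s + 1) - v ^ (s + 1)) + (u - v) * v ^ s * v := by ring
    have e2 : ((s : ℝ) + 1 + 1) * ((u - v) * v ^ (s + 1)) =
      u * ((s + 1) * ((u - v) * v ^ s)) + (u - v) * v ^ s * v
        - (u - v) * v ^ s * (u - v) * (s + 1) := by ring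
    linarith

/-- The sum is a lower Riemann sum of the decreasing function `(1 - x) ^ s`, the masses `q y` being
the step widths; the integral telescopes. -/
lemma sum_mul_one_sub_pow_le {α : Type*} [LinearOrder α] (t : Finset α) {q : α → ℝ}
    (hq : ∀ x, 0 ≤ q x) (ht : ∑ x ∈ t, q x ≤ 1) (s : ℕ) :
    (s + 1) * ∑ y ∈ t, q y * (1 - ∑ z ∈ t with z ≤ y, q z) ^ s ≤
      1 - (1 - ∑ x ∈ t, q x) ^ (s + 1) := by
  induction t using Finset.induction_on_max with
  | empty => simp
  | insert a t hlt ih =>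
    have ha : a ∉ t := fun h => lt_irrefl a (hlt a h)
    rw [Finset.sum_insert ha] at ht ⊢
    have h1 : ((insert a t).filter fun z => z ≤ a) = insert a t := by
      refine Finset.filter_true_of_mem fun x hx => ?_
      rcases Finset.mem_insert.1 hx with rfl | hx
      exacts [le_rfl, (hlt x hx).le]
    have h2 : ∑ y ∈ t, q y * (1 - ∑ z ∈ insert a t with z ≤ y, q z) ^ s =
        ∑ y ∈ t, q y * (1 - ∑ z ∈ t with z ≤ y, q z) ^ s := by
      refine Finset.sum_congr rfl fun y hy => ?_
      rw [Finset.filter_insert, if_neg (not_le.2 (hlt y hy))]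
    rw [h1, h2, Finset.sum_insert ha]
    have h3 := ih (by linarith [hq a])
    have h4 := succ_mul_sub_mul_pow_le (u := 1 - ∑ x ∈ t, q x) (v := 1 - (q a + ∑ x ∈ t, q x))
      (by linarith) (by linarith [hq a]) s
    have e : 1 - ∑ x ∈ t, q x - (1 - (q a + ∑ x ∈ t, q x)) = q a := by ring
    rw [e] at h4
    linarith

lemma sum_mul_one_sub_pow_le' {α : Type*} [LinearOrder α] (t : Finset α) {q : α → ℝ}
    (hq : ∀ x, 0 ≤ q x) (ht : ∑ x ∈ t, q x ≤ 1) (s : ℕ) :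
    ∑ y ∈ t, q y * (1 - ∑ z ∈ t with z ≤ y, q z) ^ s ≤ 1 / (s + 1) := by
  rw [le_div_iff₀' (by positivity)]
  have : 0 ≤ (1 - ∑ x ∈ t, q x) ^ (s + 1) := pow_nonneg (by linarith) _
  linarith [sum_mul_one_sub_pow_le t hq ht s]

/-- The expected mass of the points that no sample separates from a given point. -/
lemma iidExp_mass_gap_le {n : ℕ} {q : Fin n → ℝ} (hq : q ∈ stdSimplex ℝ (Fin n)) (s : ℕ)
    (x : Fin n) :
    iidExp q (fun S : Fin s → Fin n => ∑ y, q y * if ∀ j, S j ∉ Finset.uIcc x y then 1 else 0) ≤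
      2 / (s + 1) := by
  have h1 : ∀ y, iidExp q (fun S : Fin s → Fin n =>
      q y * if ∀ j, S j ∉ Finset.uIcc x y then 1 else 0)
      = q y * (1 - ∑ z ∈ Finset.uIcc x y, q z) ^ s := by
    intro y
    have e : ∀ S : Fin s → Fin n, (if ∀ j, S j ∉ Finset.uIcc x y then (1 : ℝ) else 0) =
        ∏ j, if S j ∉ Finset.uIcc x y then 1 else 0 := fun S => by
      rw [Finset.prod_ite_zero]; simp
    rw [iidExp_mul_left]
    simp only [e]
    rw [iidExp_prod q fun _ z => if z ∉ Finset.uIcc x y then (1 : ℝ) else 0, Finset.prod_const,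
      Finset.card_univ, Fintype.card_fin]
    congr 2
    rw [← hq.2, eq_sub_iff_add_eq, ← Finset.univ_inter (Finset.uIcc x y), ← Finset.sum_ite_mem,
      Finset.univ_inter, ← Finset.sum_add_distrib]
    refine Finset.sum_congr rfl fun z _ => ?_
    by_cases hz : z ∈ Finset.uIcc x y <;> simp [hz, hq.2]
  rw [iidExp_sum]
  simp only [h1]
  have hsub : ∀ t : Finset (Fin n), ∑ x ∈ t, q x ≤ 1 := fun t =>
    hq.2 ▸ Finset.sum_le_sum_of_subset_of_nonneg (Finset.subset_univ t) fun z _ _ => hq.1 z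
  have h2 := sum_mul_one_sub_pow_le' (Finset.univ.filter fun y => x ≤ y) hq.1 (hsub _) s
  have h3 := sum_mul_one_sub_pow_le' (α := (Fin n)ᵒᵈ) (Finset.univ.filter fun y : Fin n => y ≤ x)
    hq.1 (hsub _) s
  have hnn : ∀ y, 0 ≤ q y * (1 - ∑ z ∈ Finset.uIcc x y, q z) ^ s := fun y =>
    mul_nonneg (hq.1 y) (pow_nonneg (by linarith [hsub (Finset.uIcc x y)]) _)
  -- Each side of `x` contributes at most `1 / (s + 1)`; the point `x` itself is counted twice.
  calc ∑ y, q y * (1 - ∑ z ∈ Finset.uIcc x y, q z) ^ s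
      ≤ ∑ y with x ≤ y, q y * (1 - ∑ z ∈ Finset.uIcc x y, q z) ^ s
        + ∑ y with y ≤ x, q y * (1 - ∑ z ∈ Finset.uIcc x y, q z) ^ s := by
        rw [← Finset.sum_filter_add_sum_filter_not Finset.univ (fun y => x ≤ y)]
        gcongr
        · exact fun y _ _ => hnn y
        · rename_i y hy
          exact fun h => (not_le.1 h).le
    _ ≤ 1 / (s + 1) + 1 / (s + 1) := by
        refine add_le_add (le_trans (le_of_eq ?_) h2) (le_trans (le_of_eq ?_) h3)
        · refine Finset.sum_congr rfl fun y hy => ?_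
          have hxy := (Finset.mem_filter.1 hy).2
          rw [Finset.uIcc_of_le hxy]
          congr 3
          refine Finset.sum_congr ?_ fun _ _ => rfl
          ext z; simp
        · refine Finset.sum_congr rfl fun y hy => ?_
          have hxy : y ≤ x := (Finset.mem_filter.1 hy).2
          rw [Finset.uIcc_of_ge hxy]
          congr 3
          refine Finset.sum_congr ?_ fun _ _ => rfl
          ext z
          rw [Finset.mem_Icc]
          refine ⟨fun h => Finset.mem_filter.2 ⟨Finset.mem_filter.2 ⟨Finset.mem_univ z, h.2⟩, h.1⟩,
            fun h => ?_⟩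
          exact ⟨(Finset.mem_filter.1 h).2, (Finset.mem_filter.1 (Finset.mem_filter.1 h).1).2⟩
    _ = 2 / (s + 1) := by ring

/-! ### The partition induced by a sample -/

section partition

variable {n s : ℕ}

/-- The number of sample points below `x`. -/
def sampleRank (S : Fin s → Fin n) (x : Fin n) : Fin (s + 1) :=
  ⟨(Finset.univ.filter fun j => S j < x).card,
    Nat.lt_succ_of_le ((Finset.card_le_univ _).trans (Fintype.card_fin s).le)⟩

/-- The points outside the sample that have exactly `r` sample points below them. -/
def sampleGap (S : Fin s → Fin n) (r : Fin (s + 1)) : Finset (Fin n) :=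
  Finset.univ.filter fun x => (∀ j, S j ≠ x) ∧ sampleRank S x = r

/-- The number of points of the gap of `x` up to `x`. -/
def gapLeft (S : Fin s → Fin n) (x : Fin n) : ℕ :=
  ((sampleGap S (sampleRank S x)).filter fun z => z ≤ x).card

/-- The number of points of the gap of `x` from `x` on. -/
def gapRight (S : Fin s → Fin n) (x : Fin n) : ℕ :=
  ((sampleGap S (sampleRank S x)).filter fun z => x ≤ z).card

/-- Labels for the bins of the partition: a sample point forms a bin of its own, and each gap is
divided into bins of geometrically growing size from both ends. -/
abbrev BinLabel (n s : ℕ) (η : ℝ) : Type :=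
  Fin (s + 1) × Option (Bool × Fin (⌊Real.log n / η⌋₊ + 1))

/-- The bin of `x` in the partition induced by the sample `S`. -/
noncomputable def binLabel (S : Fin s → Fin n) (η : ℝ) (x : Fin n) : BinLabel n s η :=
  (sampleRank S x, if ∀ j, S j ≠ x then
    some (decide (gapLeft S x ≤ gapRight S x),
      ⟨min ⌊Real.log (min (gapLeft S x) (gapRight S x) : ℕ) / η⌋₊ ⌊Real.log n / η⌋₊,
        Nat.lt_succ_of_le (min_le_right _ _)⟩) else none)

variable {S : Fin s → Fin n}

lemma sampleRank_mono {x y : Fin n} (h : x ≤ y) : sampleRank S x ≤ sampleRank S y := by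
  simp only [Fin.le_def, sampleRank]
  refine Finset.card_le_card fun j hj => ?_
  simp only [Finset.mem_filter] at hj ⊢
  exact ⟨hj.1, hj.2.trans_le h⟩

lemma sampleRank_lt {j : Fin s} {y : Fin n} (h : S j < y) :
    sampleRank S (S j) < sampleRank S y := by
  simp only [Fin.lt_def, sampleRank]
  refine Finset.card_lt_card ⟨fun i hi => ?_, fun hs => ?_⟩
  · simp only [Finset.mem_filter] at hi ⊢
    exact ⟨hi.1, hi.2.trans h⟩
  · have := hs (Finset.mem_filter.2 ⟨Finset.mem_univ j, h⟩)
    simp at this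

lemma mem_sampleGap {r : Fin (s + 1)} {x : Fin n} :
    x ∈ sampleGap S r ↔ (∀ j, S j ≠ x) ∧ sampleRank S x = r := by
  simp [sampleGap]

lemma mem_sampleGap_of_le_of_le {r : Fin (s + 1)} {x y z : Fin n} (hx : x ∈ sampleGap S r)
    (hy : y ∈ sampleGap S r) (hxz : x ≤ z) (hzy : z ≤ y) : z ∈ sampleGap S r := by
  rw [mem_sampleGap] at *
  have h1 := sampleRank_mono (S := S) hxz
  have h2 := sampleRank_mono (S := S) hzy
  rw [hx.2] at h1
  rw [hy.2] at h2
  have hz := le_antisymm h2 h1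
  refine ⟨fun j hj => ?_, hz⟩
  have hlt : S j < y := lt_of_le_of_ne (hj ▸ hzy) (hy.1 j)
  have := sampleRank_lt hlt
  rw [hj, hz, hy.2] at this
  exact lt_irrefl _ this

lemma not_mem_uIcc_of_mem_sampleGap {r : Fin (s + 1)} {x y : Fin n} (hx : x ∈ sampleGap S r)
    (hy : y ∈ sampleGap S r) (j : Fin s) : S j ∉ Finset.uIcc x y := by
  intro h
  have : S j ∈ sampleGap S r := by
    rcases le_total x y with hxy | hxy
    · rw [Finset.uIcc_of_le hxy, Finset.mem_Icc] at h
      exact mem_sampleGap_of_le_of_le hx hy h.1 h.2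
    · rw [Finset.uIcc_of_ge hxy, Finset.mem_Icc] at h
      exact mem_sampleGap_of_le_of_le hy hx h.1 h.2
  exact (mem_sampleGap.1 this).1 j rfl

variable {η : ℝ}

/-- A sample point has the same rank as the points of the gap just below it, so the `none` tag is
what isolates it; distinct sample points differ in rank. -/
lemma binLabel_eq_iff_of_sampled {x y : Fin n} (hx : ¬ ∀ j, S j ≠ x) :
    binLabel S η y = binLabel S η x ↔ y = x := by
  refine ⟨fun h => ?_, fun h => h ▸ rfl⟩
  simp only [binLabel, if_neg hx, Prod.mk.injEq] at h
  obtain ⟨h1, h2⟩ := h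
  have hy : ¬ ∀ j, S j ≠ y := fun hy => by simp [hy] at h2
  push Not at hx hy
  obtain ⟨i, rfl⟩ := hx
  obtain ⟨j, rfl⟩ := hy
  rcases lt_trichotomy (S i) (S j) with h | h | h
  · exact absurd h1 (sampleRank_lt h).ne'
  · exact h.symm
  · exact absurd h1 (sampleRank_lt h).ne

lemma mem_sampleGap_of_binLabel_eq {x y : Fin n} {r : Fin (s + 1)} (hx : x ∈ sampleGap S r)
    (h : binLabel S η y = binLabel S η x) : y ∈ sampleGap S r := by
  rw [mem_sampleGap] at *
  simp only [binLabel, if_pos hx.1, Prod.mk.injEq] at h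
  refine ⟨?_, h.1.trans hx.2⟩
  by_contra hy
  simp [hy] at h

lemma filter_lt_le_sampleGap {r : Fin (s + 1)} {x y : Fin n} (hx : x ∈ sampleGap S r)
    (hy : y ∈ sampleGap S r) :
    ((sampleGap S r).filter fun z => x < z ∧ z ≤ y) = Finset.Ioc x y := by
  ext z
  simp only [Finset.mem_filter, Finset.mem_Ioc, and_iff_right_iff_imp]
  exact fun h => mem_sampleGap_of_le_of_le hx hy h.1.le h.2

lemma filter_lt_and_le_sampleGap {r : Fin (s + 1)} {x y : Fin n} (hx : x ∈ sampleGap S r)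
    (hy : y ∈ sampleGap S r) :
    ((sampleGap S r).filter fun z => z < y ∧ x ≤ z) = Finset.Ico x y := by
  ext z
  simp only [Finset.mem_filter, Finset.mem_Ico]
  exact ⟨fun h => ⟨h.2.2, h.2.1⟩,
    fun h => ⟨mem_sampleGap_of_le_of_le hx hy h.1 h.2.le, h.2, h.1⟩⟩

lemma gapLeft_add {r : Fin (s + 1)} {x y : Fin n} (hx : x ∈ sampleGap S r)
    (hy : y ∈ sampleGap S r) (hxy : x ≤ y) : gapLeft S y = gapLeft S x + (y - x : ℕ) := by
  rw [gapLeft, gapLeft, (mem_sampleGap.1 hx).2, (mem_sampleGap.1 hy).2, ← Fin.card_Ioc,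
    ← filter_lt_le_sampleGap hx hy,
    ← Finset.card_filter_add_card_filter_not (s := (sampleGap S r).filter fun z => z ≤ y)
      (fun z => z ≤ x), Finset.filter_filter, Finset.filter_filter]
  congr 2
  · refine Finset.filter_congr fun z _ => ⟨fun h => h.2, fun h => ⟨h.trans hxy, h⟩⟩
  · refine Finset.filter_congr fun z _ => ⟨fun h => ⟨not_le.1 h.2, h.1⟩,
      fun h => ⟨h.2, not_le.2 h.1⟩⟩

lemma gapRight_add {r : Fin (s + 1)} {x y : Fin n} (hx : x ∈ sampleGap S r)
    (hy : y ∈ sampleGap S r) (hxy : x ≤ y) : gapRight S x = gapRight S y + (y - x : ℕ) := by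
  rw [gapRight, gapRight, (mem_sampleGap.1 hx).2, (mem_sampleGap.1 hy).2, ← Fin.card_Ico,
    ← filter_lt_and_le_sampleGap hx hy,
    ← Finset.card_filter_add_card_filter_not (s := (sampleGap S r).filter fun z => x ≤ z)
      (fun z => y ≤ z), Finset.filter_filter, Finset.filter_filter]
  congr 2
  · refine Finset.filter_congr fun z _ => ⟨fun h => h.2, fun h => ⟨hxy.trans h, h⟩⟩
  · refine Finset.filter_congr fun z _ => ⟨fun h => ⟨not_le.1 h.2, h.1⟩,
      fun h => ⟨h.2, not_le.2 h.1⟩⟩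

lemma gapLeft_le : gapLeft S x ≤ n := (Finset.card_le_univ _).trans (Fintype.card_fin n).le

lemma one_le_gapLeft {r : Fin (s + 1)} {x : Fin n} (hx : x ∈ sampleGap S r) :
    1 ≤ gapLeft S x := by
  rw [gapLeft, (mem_sampleGap.1 hx).2]
  exact Finset.card_pos.2 ⟨x, by simp [hx]⟩

lemma one_le_gapRight {r : Fin (s + 1)} {x : Fin n} (hx : x ∈ sampleGap S r) :
    1 ≤ gapRight S x := by
  rw [gapRight, (mem_sampleGap.1 hx).2]
  exact Finset.card_pos.2 ⟨x, by simp [hx]⟩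

/-- Equal floors force `a + d < a * exp η`, and `exp η ≤ 1 + 2 * η` for `η ≤ 1 / 2`. -/
lemma sub_le_of_floor_log_eq {a d : ℕ} (ha : 1 ≤ a) (hη : 0 < η) (hη' : η ≤ 1 / 2)
    (h : ⌊Real.log a / η⌋₊ = ⌊Real.log (a + d : ℕ) / η⌋₊) : (d : ℝ) ≤ 2 * η * a := by
  have ha' : (0 : ℝ) < a := by exact_mod_cast ha
  have h1 : Real.log (a + d : ℕ) / η < Real.log a / η + 1 := by
    refine (Nat.lt_floor_add_one _).trans_le ?_
    rw [← h]
    gcongr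
    exact Nat.floor_le (div_nonneg (Real.log_nonneg (by exact_mod_cast ha)) hη.le)
  rw [div_add_one hη.ne', div_lt_div_iff_of_pos_right hη,
    Real.log_lt_iff_lt_exp (by exact_mod_cast (by omega : 0 < a + d)), Real.exp_add,
    Real.exp_log ha'] at h1
  have h2 : Real.exp η ≤ 1 + 2 * η := by
    have h3 := Real.add_one_le_exp (-η)
    rw [Real.exp_neg] at h3
    have h4 : Real.exp η * (-η + 1) ≤ 1 := by
      calc _ ≤ Real.exp η * (Real.exp η)⁻¹ := by gcongr
        _ = 1 := mul_inv_cancel₀ (Real.exp_pos _).ne'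
    nlinarith [Real.exp_pos η]
  push_cast at h1
  nlinarith [mul_le_mul_of_nonneg_left h2 ha'.le]

/-- Bins are short compared with their distance from either end of their gap. -/
lemma sub_le_of_binLabel_eq {r : Fin (s + 1)} {x y : Fin n} (hη : 0 < η) (hη' : η ≤ 1 / 2)
    (hx : x ∈ sampleGap S r) (hy : y ∈ sampleGap S r) (hxy : x < y)
    (h : binLabel S η x = binLabel S η y) :
    ((y - x : ℕ) : ℝ) ≤ 2 * η * gapLeft S x ∧ ((y - x : ℕ) : ℝ) ≤ 2 * η * gapRight S y := by
  have hL := gapLeft_add hx hy hxy.le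
  have hR := gapRight_add hx hy hxy.le
  -- The cap in `binLabel` never takes effect; it only supplies the bound required by `Fin`.
  have hfl : ∀ z : Fin n, ⌊Real.log (min (gapLeft S z) (gapRight S z) : ℕ) / η⌋₊ ≤
      ⌊Real.log n / η⌋₊ := by
    intro z
    rcases Nat.eq_zero_or_pos (min (gapLeft S z) (gapRight S z)) with h0 | h0
    · simp [h0]
    · gcongr
      exact (min_le_left _ _).trans gapLeft_le
  simp only [binLabel, if_pos (mem_sampleGap.1 hx).1, if_pos (mem_sampleGap.1 hy).1, hfl,
    min_eq_left, Prod.mk.injEq, Option.some.injEq, decide_eq_decide, Fin.mk.injEq] at h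
  obtain ⟨-, hside, hfloor⟩ := h
  have h2η : 0 ≤ 2 * η := by linarith
  -- A bin stays in one half of its gap, and its length is controlled by the distance to the nearer
  -- end. The distance to the other end is at least as large, so both estimates follow.
  rcases le_or_gt (gapLeft S x) (gapRight S x) with hle | hlt
  · have hle' := hside.1 hle
    rw [min_eq_left hle, min_eq_left hle', hL] at hfloor
    have := sub_le_of_floor_log_eq (one_le_gapLeft hx) hη hη' hfloor
    refine ⟨this, this.trans (mul_le_mul_of_nonneg_left ?_ h2η)⟩
    exact_mod_cast (by omega : gapLeft S x ≤ gapRight S y)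
  · have hlt' : gapRight S y < gapLeft S y := not_le.1 fun h' => not_le.2 hlt (hside.2 h')
    rw [min_eq_right hlt.le, min_eq_right hlt'.le, hR] at hfloor
    have := sub_le_of_floor_log_eq (one_le_gapRight hy) hη hη' hfloor.symm
    refine ⟨this.trans (mul_le_mul_of_nonneg_left ?_ h2η), this⟩
    exact_mod_cast (by omega : gapRight S y ≤ gapLeft S x)

/-- The points whose gap contains a point of `M`. -/
def badPoints (S : Fin s → Fin n) (M : Finset (Fin n)) : Finset (Fin n) :=
  Finset.univ.filter fun x => ∃ m ∈ M, ∃ r, x ∈ sampleGap S r ∧ m ∈ sampleGap S r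

lemma mem_badPoints_of_binLabel_eq {M : Finset (Fin n)} {x y : Fin n} (hx : x ∈ badPoints S M)
    (h : binLabel S η y = binLabel S η x) : y ∈ badPoints S M := by
  simp only [badPoints, Finset.mem_filter, Finset.mem_univ, true_and] at *
  obtain ⟨m, hm, r, hxr, hmr⟩ := hx
  exact ⟨m, hm, r, mem_sampleGap_of_binLabel_eq hxr h, hmr⟩

/-- A union bound over `M`: a bad point is joined to some point of `M` by an interval free of
samples. -/
lemma iidExp_mass_badPoints_le {q : Fin n → ℝ} (hq : q ∈ stdSimplex ℝ (Fin n))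
    (M : Finset (Fin n)) :
    iidExp q (fun S : Fin s → Fin n => ∑ x ∈ badPoints S M, q x) ≤ M.card * (2 / (s + 1)) := by
  calc _ ≤ iidExp q (fun S : Fin s → Fin n =>
        ∑ m ∈ M, ∑ y, q y * if ∀ j, S j ∉ Finset.uIcc m y then 1 else 0) := by
        refine iidExp_mono hq.1 fun S => ?_
        rw [Finset.sum_comm, badPoints, Finset.sum_filter]
        refine Finset.sum_le_sum fun y _ => ?_
        have hnn : ∀ m ∈ M, 0 ≤ q y * if ∀ j, S j ∉ Finset.uIcc m y then (1 : ℝ) else 0 :=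
          fun m _ => mul_nonneg (hq.1 y) (by split_ifs <;> norm_num)
        split_ifs with h
        · obtain ⟨m, hm, r, hyr, hmr⟩ := h
          refine le_trans ?_ (Finset.single_le_sum hnn hm)
          rw [if_pos (not_mem_uIcc_of_mem_sampleGap hmr hyr), mul_one]
        · exact Finset.sum_nonneg hnn
    _ ≤ _ := by
        rw [iidExp_sum, ← nsmul_eq_mul]
        exact Finset.sum_le_card_nsmul _ _ _ fun m _ => iidExp_mass_gap_le hq s m

/-- Outside the bad points, averaging over bins changes a piecewise monotone function little. -/
lemma sum_abs_sub_binAverage_le {f : Fin n → ℝ} (hf0 : ∀ x, 0 ≤ f x) {M : Finset (Fin n)}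
    (hf : ∀ J : Set (Fin n), J.OrdConnected → Disjoint J M → MonotoneOn f J ∨ AntitoneOn f J)
    (S : Fin s → Fin n) (hη : 0 < η) (hη' : η ≤ 1 / 2) :
    ∑ x ∈ (badPoints S M)ᶜ, |f x - (∑ y with binLabel S η y = binLabel S η x, f y) /
      (Finset.univ.filter fun y => binLabel S η y = binLabel S η x).card| ≤
      2 * (2 * η) * ∑ x, f x := by
  set g : Fin n → ℝ := fun x => |f x - (∑ y with binLabel S η y = binLabel S η x, f y) /
      (Finset.univ.filter fun y => binLabel S η y = binLabel S η x).card| with hg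
  have h0 : ∀ x, (¬ ∀ j, S j ≠ x) → g x = 0 := by
    intro x hx
    simp [hg, binLabel_eq_iff_of_sampled hx, Finset.filter_eq']
  have hgap : ∀ r, (∀ m ∈ M, m ∉ sampleGap S r) →
      ∑ x ∈ sampleGap S r, g x ≤ 2 * (2 * η) * ∑ x ∈ sampleGap S r, f x := by
    intro r hr
    have hoc : (sampleGap S r : Set (Fin n)).OrdConnected :=
      ⟨fun x hx y hy z hz => mem_sampleGap_of_le_of_le hx hy hz.1 hz.2⟩
    have hd : Disjoint (sampleGap S r : Set (Fin n)) M :=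
      Set.disjoint_right.2 fun m hm hm' => hr m hm hm'
    have hfil : ∀ x ∈ sampleGap S r,
        (Finset.univ.filter fun y => binLabel S η y = binLabel S η x) =
        (sampleGap S r).filter fun y => binLabel S η y = binLabel S η x := by
      intro x hx
      ext y
      simp only [Finset.mem_filter, Finset.mem_univ, true_and]
      exact ⟨fun h => ⟨mem_sampleGap_of_binLabel_eq hx h, h⟩, fun h => h.2⟩
    have hcongr : ∑ x ∈ sampleGap S r, g x = ∑ x ∈ sampleGap S r,
        |f x - (∑ y ∈ sampleGap S r with binLabel S η y = binLabel S η x, f y) /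
          ((sampleGap S r).filter fun y => binLabel S η y = binLabel S η x).card| :=
      Finset.sum_congr rfl fun x hx => by simp only [hg, hfil x hx]
    rw [hcongr]
    rcases hf _ hoc hd with hmono | hanti
    · refine sum_abs_sub_average_le_of_monotoneOn _ _ (by linarith) hmono (fun x _ => hf0 x) ?_
      intro x hx y hy hxy hc
      rw [filter_lt_and_le_sampleGap hx hy, Fin.card_Ico]
      have := (sub_le_of_binLabel_eq hη hη' hx hy hxy hc).2
      rwa [gapRight, (mem_sampleGap.1 hy).2] at this
    · refine sum_abs_sub_average_le_of_antitoneOn _ _ (by linarith) hanti (fun x _ => hf0 x) ?_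
      intro x hx y hy hxy hc
      rw [filter_lt_le_sampleGap hx hy, Fin.card_Ioc]
      have := (sub_le_of_binLabel_eq hη hη' hx hy hxy hc).1
      rwa [gapLeft, (mem_sampleGap.1 hx).2] at this
  -- Each rank class consists of one gap and possibly a sample point, which is its own average and
  -- contributes nothing. If the gap meets `M`, then no other point of the class survives outside
  -- the bad set.
  rw [← Finset.sum_fiberwise (badPoints S M)ᶜ (sampleRank S) g,
    ← Finset.sum_fiberwise Finset.univ (sampleRank S) f, Finset.mul_sum]
  refine Finset.sum_le_sum fun r _ => ?_
  have hfr : ∑ x ∈ sampleGap S r, f x ≤ ∑ x with sampleRank S x = r, f x :=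
    Finset.sum_le_sum_of_subset_of_nonneg
      (fun x hx => Finset.mem_filter.2 ⟨Finset.mem_univ x, (mem_sampleGap.1 hx).2⟩)
      fun x _ _ => hf0 x
  have hg0 : ∀ x, 0 ≤ g x := fun x => abs_nonneg _
  by_cases hr : ∀ m ∈ M, m ∉ sampleGap S r
  · refine le_trans ?_ ((hgap r hr).trans (mul_le_mul_of_nonneg_left hfr (by linarith)))
    rw [← Finset.sum_filter_add_sum_filter_not _ (fun x => ∀ j, S j ≠ x),
      Finset.sum_eq_zero (s := Finset.filter (fun x => ¬ ∀ j, S j ≠ x) _) fun x hx =>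
        h0 x (Finset.mem_filter.1 hx).2, add_zero]
    refine Finset.sum_le_sum_of_subset_of_nonneg (fun x hx => ?_) fun x _ _ => hg0 x
    simp only [Finset.mem_filter] at hx
    exact mem_sampleGap.2 ⟨hx.2, hx.1.2⟩
  · push Not at hr
    obtain ⟨m, hm, hmr⟩ := hr
    rw [Finset.sum_eq_zero]
    · exact mul_nonneg (by linarith) (Finset.sum_nonneg fun x _ => hf0 x)
    · intro x hx
      simp only [Finset.mem_filter, Finset.mem_compl, badPoints, Finset.mem_univ, true_and] at hx
      exact h0 x fun hx' => hx.1 ⟨m, hm, r, mem_sampleGap.2 ⟨hx', hx.2⟩, hmr⟩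

end partition

/-- Two distributions that are nearly constant on the bins of a partition, apart from a union of
bins of small mass, are close if their masses on the bins are close. -/
lemma sum_abs_sub_le_of_partition {n : ℕ} {Λ : Type*} [Fintype Λ] [DecidableEq Λ]
    (c : Fin n → Λ) {p q : Fin n → ℝ} (hp0 : ∀ x, 0 ≤ p x) (hq0 : ∀ x, 0 ≤ q x)
    (B : Finset (Fin n)) (hB : ∀ x ∈ B, ∀ y, c y = c x → y ∈ B) {κ : ℝ}
    (hp : ∑ x ∈ Bᶜ, |p x - (∑ y with c y = c x, p y) /
      (Finset.univ.filter fun y => c y = c x).card| ≤ κ)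
    (hq : ∑ x ∈ Bᶜ, |q x - (∑ y with c y = c x, q y) /
      (Finset.univ.filter fun y => c y = c x).card| ≤ κ) :
    ∑ x, |p x - q x| ≤ 2 * ∑ I, |∑ y with c y = I, p y - ∑ y with c y = I, q y| +
      2 * ∑ x ∈ B, q x + 2 * κ := by
  set Δ : Λ → ℝ := fun I => ∑ y with c y = I, p y - ∑ y with c y = I, q y with hΔ
  set N : Fin n → ℝ := fun x => (Finset.univ.filter fun y => c y = c x).card with hN
  have hNpos : ∀ x, 0 < N x := fun x => by
    simp only [hN, Nat.cast_pos, Finset.card_pos]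
    exact ⟨x, by simp⟩
  have hgood : ∑ x ∈ Bᶜ, |p x - q x| ≤ κ + κ + ∑ I, |Δ I| := by
    have h1 : ∀ x ∈ Bᶜ, |p x - q x| ≤ |p x - (∑ y with c y = c x, p y) / N x| +
        |q x - (∑ y with c y = c x, q y) / N x| + |Δ (c x)| / N x := by
      intro x _
      have e : p x - q x = (p x - (∑ y with c y = c x, p y) / N x) -
          (q x - (∑ y with c y = c x, q y) / N x) + Δ (c x) / N x := by
        simp only [hΔ]; ring
      rw [e]
      refine (abs_add_le _ _).trans (add_le_add (abs_sub _ _) ?_)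
      rw [abs_div, abs_of_pos (hNpos x)]
    refine (Finset.sum_le_sum h1).trans ?_
    rw [Finset.sum_add_distrib, Finset.sum_add_distrib]
    refine add_le_add (add_le_add hp hq) ?_
    calc ∑ x ∈ Bᶜ, |Δ (c x)| / N x ≤ ∑ x, |Δ (c x)| / N x :=
          Finset.sum_le_sum_of_subset_of_nonneg (Finset.subset_univ _) fun x _ _ =>
            div_nonneg (abs_nonneg _) (hNpos x).le
      _ = ∑ I, ∑ x with c x = I, |Δ (c x)| / N x := (Finset.sum_fiberwise _ _ _).symm
      _ ≤ ∑ I, |Δ I| := by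
        refine Finset.sum_le_sum fun I _ => ?_
        have : ∀ x ∈ Finset.univ.filter (fun x => c x = I), |Δ (c x)| / N x =
            |Δ I| / (Finset.univ.filter fun y => c y = I).card := by
          intro x hx
          simp only [hN, (Finset.mem_filter.1 hx).2]
        rw [Finset.sum_congr rfl this, Finset.sum_const, nsmul_eq_mul]
        rcases Nat.eq_zero_or_pos (Finset.univ.filter fun y => c y = I).card with h | h
        · simp [h]
        · rw [mul_div_cancel₀ _ (by positivity)]
  -- Only the `q`-mass of `B` is assumed small. As `B` is a union of bins, its `p`-mass exceeds its
  -- `q`-mass by at most `∑ I, |Δ I|`.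
  have hbad : ∑ x ∈ B, |p x - q x| ≤ 2 * ∑ x ∈ B, q x + ∑ I, |Δ I| := by
    have h1 : ∑ x ∈ B, (p x - q x) ≤ ∑ I, |Δ I| := by
      rw [← Finset.sum_fiberwise B c]
      refine Finset.sum_le_sum fun I _ => ?_
      by_cases hI : ∃ x ∈ B, c x = I
      · obtain ⟨x, hx, rfl⟩ := hI
        have : (B.filter fun y => c y = c x) = Finset.univ.filter fun y => c y = c x := by
          ext y
          simp only [Finset.mem_filter, Finset.mem_univ, true_and, and_iff_right_iff_imp]
          exact hB x hx y
        rw [this, Finset.sum_sub_distrib]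
        exact le_abs_self _
      · rw [Finset.filter_false_of_mem fun x hx h => hI ⟨x, hx, h⟩]
        simp
    have h2 : ∑ x ∈ B, |p x - q x| ≤ ∑ x ∈ B, (2 * q x + (p x - q x)) := by
      refine Finset.sum_le_sum fun x _ => ?_
      rw [abs_le]
      constructor <;> linarith [hp0 x, hq0 x]
    rw [Finset.sum_add_distrib, ← Finset.mul_sum] at h2
    linarith
  rw [← Finset.sum_compl_add_sum B]
  linarith

/-! ### Two-sample kernel statistics -/

section kernel

variable {β : Type*} [Fintype β] {ρ : β → ℝ} {h : β → β → ℝ}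

/-- The sum of a kernel over all pairs formed from two samples. -/
def kernelStat {m : ℕ} (h : β → β → ℝ) (z z' : Fin m → β) : ℝ := ∑ j, ∑ i, h (z i) (z' j)

lemma iidExp_kernelStat (hρ : ρ ∈ stdSimplex ℝ β) (m : ℕ) :
    iidExp ρ (fun z : Fin m → β => iidExp ρ fun z' : Fin m → β => kernelStat h z z') =
      m ^ 2 * ∑ u, ρ u * ∑ v, ρ v * h u v := by
  have h1 : ∀ z : Fin m → β, iidExp ρ (fun z' : Fin m → β => kernelStat h z z') =
      ∑ i, m * ∑ v, ρ v * h (z i) v := by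
    intro z
    simp only [kernelStat]
    rw [iidExp_sum_apply hρ fun v => ∑ i, h (z i) v, Fintype.card_fin, ← Finset.mul_sum,
      Finset.sum_comm]
    simp only [Finset.mul_sum]
  simp only [h1]
  rw [iidExp_sum_apply hρ fun u => m * ∑ v, ρ v * h u v, Fintype.card_fin, sq, mul_assoc,
    Finset.mul_sum (a := (m : ℝ)) (s := Finset.univ) (f := fun u => ρ u * ∑ v, ρ v * h u v)]
  congr 1
  exact Finset.sum_congr rfl fun u _ => by ring

/-- For fixed `z` the statistic is a sum of independent terms in `z'`; `iidExp_sq_sum_le` is applied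
first to `z'` and then to `z`. Symmetry of the kernel merges the two cubic terms. -/
lemma iidExp_kernelStat_sq_le (hρ : ρ ∈ stdSimplex ℝ β) (hsymm : ∀ u v, h u v = h v u) (m : ℕ) :
    iidExp ρ (fun z : Fin m → β => iidExp ρ fun z' : Fin m → β => kernelStat h z z' ^ 2) ≤
      m ^ 2 * (∑ u, ρ u * ∑ v, ρ v * h u v ^ 2) + 2 * m ^ 3 * (∑ u, ρ u * (∑ v, ρ v * h u v) ^ 2)
        + (m ^ 2 * ∑ u, ρ u * ∑ v, ρ v * h u v) ^ 2 := by
  have h1 : ∀ z : Fin m → β, iidExp ρ (fun z' : Fin m → β => kernelStat h z z' ^ 2) ≤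
      m * (∑ v, ρ v * (∑ i, h v (z i)) ^ 2) + m ^ 2 * (∑ i, ∑ v, ρ v * h (z i) v) ^ 2 := by
    intro z
    refine (iidExp_sq_sum_le (ι := Fin m) hρ fun v => ∑ i, h (z i) v).trans (le_of_eq ?_)
    rw [Fintype.card_fin, mul_pow]
    congr 2
    · exact Finset.sum_congr rfl fun v _ => by
        rw [Finset.sum_congr rfl fun i _ => hsymm (z i) v]
    · rw [Finset.sum_comm]
      simp only [Finset.mul_sum]
  refine (iidExp_mono hρ.1 h1).trans ?_
  rw [iidExp_add, iidExp_mul_left, iidExp_mul_left, iidExp_sum]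
  have h2 : ∀ v, iidExp ρ (fun z : Fin m → β => ρ v * (∑ i, h v (z i)) ^ 2) ≤
      ρ v * (m * (∑ u, ρ u * h v u ^ 2) + m ^ 2 * (∑ u, ρ u * h v u) ^ 2) := by
    intro v
    rw [iidExp_mul_left]
    refine mul_le_mul_of_nonneg_left ((iidExp_sq_sum_le hρ fun u => h v u).trans (le_of_eq ?_))
      (hρ.1 v)
    rw [Fintype.card_fin, mul_pow]
  have h3 := iidExp_sq_sum_le (ι := Fin m) hρ fun u => ∑ v, ρ v * h u v
  rw [Fintype.card_fin] at h3
  have h4 := Finset.sum_le_sum fun v (_ : v ∈ Finset.univ) => h2 v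
  have e : ∑ v, ρ v * (m * (∑ u, ρ u * h v u ^ 2) + m ^ 2 * (∑ u, ρ u * h v u) ^ 2) =
      m * (∑ u, ρ u * ∑ v, ρ v * h u v ^ 2) + m ^ 2 * ∑ u, ρ u * (∑ v, ρ v * h u v) ^ 2 := by
    rw [Finset.mul_sum, Finset.mul_sum, ← Finset.sum_add_distrib]
    exact Finset.sum_congr rfl fun v _ => by ring
  rw [e] at h4
  have hm : (0 : ℝ) ≤ m := Nat.cast_nonneg m
  have h5 := mul_le_mul_of_nonneg_left h4 hm
  have h6 := mul_le_mul_of_nonneg_left h3 (sq_nonneg (m : ℝ))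
  refine (add_le_add h5 h6).trans (le_of_eq ?_)
  ring

/-- Chebyshev's inequality for `kernelStat`. -/
lemma iidExp_kernelStat_deviation_le (hρ : ρ ∈ stdSimplex ℝ β) (hsymm : ∀ u v, h u v = h v u)
    {m : ℕ} {E : (Fin m → β) → (Fin m → β) → Bool} {t : ℝ} (ht : 0 < t)
    (hE : ∀ z z', E z z' →
      t ≤ |kernelStat h z z' - m ^ 2 * ∑ u, ρ u * ∑ v, ρ v * h u v|) :
    iidExp ρ (fun z => iidExp ρ fun z' => if E z z' then 1 else 0) ≤
      (m ^ 2 * (∑ u, ρ u * ∑ v, ρ v * h u v ^ 2)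
        + 2 * m ^ 3 * (∑ u, ρ u * (∑ v, ρ v * h u v) ^ 2)) / t ^ 2 := by
  set μ := m ^ 2 * ∑ u, ρ u * ∑ v, ρ v * h u v with hμ
  have h1 : ∀ z z' : Fin m → β, (if E z z' then (1 : ℝ) else 0) ≤
      (1 / t ^ 2) * (kernelStat h z z' ^ 2 - (2 * μ) * kernelStat h z z' + μ ^ 2) := by
    intro z z'
    have e : kernelStat h z z' ^ 2 - (2 * μ) * kernelStat h z z' + μ ^ 2 =
      (kernelStat h z z' - μ) ^ 2 := by ring
    rw [e]
    split_ifs with hz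
    · have := pow_le_pow_left₀ ht.le (hE z z' hz) 2
      rw [sq_abs] at this
      rw [one_div, inv_mul_eq_div, le_div_iff₀ (by positivity), one_mul]
      exact this
    · positivity
  refine (iidExp_mono hρ.1 fun z => iidExp_mono hρ.1 fun z' => h1 z z').trans ?_
  simp only [iidExp_mul_left, iidExp_add, iidExp_sub, iidExp_const hρ]
  rw [iidExp_kernelStat hρ, ← hμ, one_div, inv_mul_eq_div]
  refine div_le_div_of_nonneg_right ?_ (sq_nonneg t)
  have := iidExp_kernelStat_sq_le hρ hsymm m
  rw [← hμ] at this
  linarith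

end kernel

/-! ### The weighted collision kernel -/

section collision

variable {α Λ : Type*} [DecidableEq Λ]

/-- The kernel `∑ I, w I * v u I * v u' I`, where `v u` is the difference of the indicators of the
bins of `u.1` and `u.2`. -/
def collisionKernel (c : α → Λ) (w : Λ → ℝ) (u u' : α × α) : ℝ :=
  (if c u'.1 = c u.1 then w (c u.1) else 0) - (if c u'.2 = c u.1 then w (c u.1) else 0)
    - (if c u'.1 = c u.2 then w (c u.2) else 0) + (if c u'.2 = c u.2 then w (c u.2) else 0)

variable {c : α → Λ} {w : Λ → ℝ}

lemma collisionKernel_symm (u u' : α × α) :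
    collisionKernel c w u u' = collisionKernel c w u' u := by
  have : ∀ x y : α, (if c x = c y then w (c y) else 0) = if c y = c x then w (c x) else 0 := by
    intro x y
    by_cases h : c x = c y
    · simp [h]
    · simp [h, Ne.symm h]
  simp only [collisionKernel, this u.1, this u.2]
  ring

variable [Fintype α] {p q : α → ℝ}

/-- The mass that `p` assigns to the bin `I`. -/
def binMass (c : α → Λ) (p : α → ℝ) (I : Λ) : ℝ := ∑ x with c x = I, p x

lemma binMass_nonneg (hp : ∀ x, 0 ≤ p x) (I : Λ) : 0 ≤ binMass c p I :=
  Finset.sum_nonneg fun x _ => hp x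

lemma sum_mul_ite_bin (p : α → ℝ) (I : Λ) (b : ℝ) :
    ∑ x, p x * (if c x = I then b else 0) = binMass c p I * b := by
  simp only [mul_ite, mul_zero, ← Finset.sum_filter, binMass, Finset.sum_mul]

lemma sum_prodLaw_mul {α β : Type*} [Fintype α] [Fintype β] {p : α → ℝ} {q : β → ℝ}
    (hp : ∑ x, p x = 1) (hq : ∑ x, q x = 1) (F : α → ℝ) (G : β → ℝ) :
    ∑ u : α × β, p u.1 * q u.2 * (F u.1 + G u.2) = ∑ x, p x * F x + ∑ y, q y * G y := by
  rw [Fintype.sum_prod_type]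
  simp only [mul_add, Finset.sum_add_distrib]
  congr 1
  · refine Finset.sum_congr rfl fun x _ => ?_
    simp only [mul_right_comm _ _ (F x), ← Finset.mul_sum, hq, mul_one]
  · simp only [mul_assoc, ← Finset.mul_sum, ← Finset.sum_mul, hp, one_mul]

/-- The conditional mean of the kernel: averaging over `u'` replaces the signed indicator vector of
`u'` by the vector of mass differences. -/
lemma sum_collisionKernel (hp : p ∈ stdSimplex ℝ α) (hq : q ∈ stdSimplex ℝ α) (u : α × α) :
    ∑ u' : α × α, p u'.1 * q u'.2 * collisionKernel c w u u' =
      w (c u.1) * (binMass c p (c u.1) - binMass c q (c u.1))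
        - w (c u.2) * (binMass c p (c u.2) - binMass c q (c u.2)) := by
  have e : ∀ u' : α × α, collisionKernel c w u u' =
      ((if c u'.1 = c u.1 then w (c u.1) else 0) - (if c u'.1 = c u.2 then w (c u.2) else 0)) +
      ((if c u'.2 = c u.2 then w (c u.2) else 0) - (if c u'.2 = c u.1 then w (c u.1) else 0)) :=
    fun u' => by rw [collisionKernel]; ring
  simp only [e]
  rw [sum_prodLaw_mul hp.2 hq.2
    (fun x => (if c x = c u.1 then w (c u.1) else 0) - (if c x = c u.2 then w (c u.2) else 0))
    (fun y => (if c y = c u.2 then w (c u.2) else 0) - (if c y = c u.1 then w (c u.1) else 0))]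
  simp only [mul_sub, Finset.sum_sub_distrib, sum_mul_ite_bin]
  ring

variable [Fintype Λ]

lemma sum_mul_comp_eq (c : α → Λ) (p : α → ℝ) (F : Λ → ℝ) :
    ∑ x, p x * F (c x) = ∑ I, binMass c p I * F I := by
  rw [← Finset.sum_fiberwise Finset.univ c]
  refine Finset.sum_congr rfl fun I _ => ?_
  rw [binMass, Finset.sum_mul]
  exact Finset.sum_congr rfl fun x hx => by rw [(Finset.mem_filter.1 hx).2]

lemma sum_sum_collisionKernel (hp : p ∈ stdSimplex ℝ α) (hq : q ∈ stdSimplex ℝ α) :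
    ∑ u : α × α, p u.1 * q u.2 * ∑ u' : α × α, p u'.1 * q u'.2 * collisionKernel c w u u' =
      ∑ I, w I * (binMass c p I - binMass c q I) ^ 2 := by
  simp only [sum_collisionKernel hp hq]
  have := sum_prodLaw_mul hp.2 hq.2
    (fun x => w (c x) * (binMass c p (c x) - binMass c q (c x)))
    (fun y => -(w (c y) * (binMass c p (c y) - binMass c q (c y))))
  simp only [← sub_eq_add_neg] at this
  rw [this, sum_mul_comp_eq c p fun I => w I * (binMass c p I - binMass c q I),
    sum_mul_comp_eq c q fun I => -(w I * (binMass c p I - binMass c q I)),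
    ← Finset.sum_add_distrib]
  exact Finset.sum_congr rfl fun I _ => by ring

lemma sum_sq_sum_collisionKernel_le (hp : p ∈ stdSimplex ℝ α) (hq : q ∈ stdSimplex ℝ α) :
    ∑ u : α × α, p u.1 * q u.2 *
      (∑ u' : α × α, p u'.1 * q u'.2 * collisionKernel c w u u') ^ 2 ≤
      2 * ∑ I, (binMass c p I + binMass c q I) *
        (w I * (binMass c p I - binMass c q I)) ^ 2 := by
  simp only [sum_collisionKernel hp hq]
  set F : Λ → ℝ := fun I => w I * (binMass c p I - binMass c q I) with hF
  have h1 : ∀ u : α × α, p u.1 * q u.2 * (F (c u.1) - F (c u.2)) ^ 2 ≤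
      p u.1 * q u.2 * (2 * F (c u.1) ^ 2 + 2 * F (c u.2) ^ 2) := fun u =>
    mul_le_mul_of_nonneg_left (by nlinarith [sq_nonneg (F (c u.1) + F (c u.2))])
      (mul_nonneg (hp.1 _) (hq.1 _))
  refine (Finset.sum_le_sum fun u _ => h1 u).trans (le_of_eq ?_)
  rw [sum_prodLaw_mul hp.2 hq.2 (fun x => 2 * F (c x) ^ 2) (fun y => 2 * F (c y) ^ 2),
    sum_mul_comp_eq c p fun I => 2 * F I ^ 2, sum_mul_comp_eq c q fun I => 2 * F I ^ 2,
    ← Finset.sum_add_distrib, Finset.mul_sum]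
  exact Finset.sum_congr rfl fun I _ => by ring

lemma sum_sum_sq_collisionKernel_le (hp : p ∈ stdSimplex ℝ α) (hq : q ∈ stdSimplex ℝ α) :
    ∑ u : α × α, p u.1 * q u.2 *
      ∑ u' : α × α, p u'.1 * q u'.2 * collisionKernel c w u u' ^ 2 ≤
      4 * ∑ I, (w I * (binMass c p I + binMass c q I)) ^ 2 := by
  have h1 : ∀ u u' : α × α, collisionKernel c w u u' ^ 2 ≤
      ((if c u'.1 = c u.1 then 4 * w (c u.1) ^ 2 else 0) +
        (if c u'.1 = c u.2 then 4 * w (c u.2) ^ 2 else 0)) +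
      ((if c u'.2 = c u.1 then 4 * w (c u.1) ^ 2 else 0) +
        (if c u'.2 = c u.2 then 4 * w (c u.2) ^ 2 else 0)) := by
    intro u u'
    have key : ∀ a b d e : ℝ, (a - b - d + e) ^ 2 ≤ (4 * a ^ 2 + 4 * d ^ 2) +
        (4 * b ^ 2 + 4 * e ^ 2) := fun a b d e => by
      nlinarith [sq_nonneg (a + b), sq_nonneg (a + d), sq_nonneg (a - e), sq_nonneg (b - d),
        sq_nonneg (b + e), sq_nonneg (d + e)]
    refine (key _ _ _ _).trans (le_of_eq ?_)
    simp only [ite_pow, mul_ite, ne_eq, OfNat.ofNat_ne_zero, not_false_eq_true, zero_pow, mul_zero]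
  have h2 : ∀ u : α × α, ∑ u' : α × α, p u'.1 * q u'.2 * collisionKernel c w u u' ^ 2 ≤
      4 * w (c u.1) ^ 2 * (binMass c p (c u.1) + binMass c q (c u.1)) +
      4 * w (c u.2) ^ 2 * (binMass c p (c u.2) + binMass c q (c u.2)) := by
    intro u
    refine (Finset.sum_le_sum fun u' _ => mul_le_mul_of_nonneg_left (h1 u u')
      (mul_nonneg (hp.1 _) (hq.1 _))).trans (le_of_eq ?_)
    rw [sum_prodLaw_mul hp.2 hq.2
      (fun x => (if c x = c u.1 then 4 * w (c u.1) ^ 2 else 0) +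
        (if c x = c u.2 then 4 * w (c u.2) ^ 2 else 0))
      (fun x => (if c x = c u.1 then 4 * w (c u.1) ^ 2 else 0) +
        (if c x = c u.2 then 4 * w (c u.2) ^ 2 else 0))]
    simp only [mul_add, Finset.sum_add_distrib, sum_mul_ite_bin]
    ring
  refine (Finset.sum_le_sum fun u _ => mul_le_mul_of_nonneg_left (h2 u)
    (mul_nonneg (hp.1 _) (hq.1 _))).trans (le_of_eq ?_)
  rw [sum_prodLaw_mul hp.2 hq.2
    (fun x => 4 * w (c x) ^ 2 * (binMass c p (c x) + binMass c q (c x)))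
    (fun x => 4 * w (c x) ^ 2 * (binMass c p (c x) + binMass c q (c x))),
    sum_mul_comp_eq c p fun I => 4 * w I ^ 2 * (binMass c p I + binMass c q I),
    sum_mul_comp_eq c q fun I => 4 * w I ^ 2 * (binMass c p I + binMass c q I),
    ← Finset.sum_add_distrib, Finset.mul_sum]
  exact Finset.sum_congr rfl fun I _ => by ring

/-- A bound on the deviations of the collision statistic, in terms of its normalized mean
`∑ I, w I * Δ I ^ 2` and of the weighted collision probability `∑ I, (w I * q I) ^ 2`. -/
lemma iidExp_collision_deviation_le (hp : p ∈ stdSimplex ℝ α) (hq : q ∈ stdSimplex ℝ α)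
    (hw0 : ∀ I, 0 ≤ w I) (hw1 : ∀ I, w I ≤ 1) {τ B l : ℝ}
    (hτ : τ = ∑ I, w I * (binMass c p I - binMass c q I) ^ 2)
    (hB : B = ∑ I, (w I * binMass c q I) ^ 2) (hl : 0 < l) {m : ℕ}
    {E : (Fin m → α × α) → (Fin m → α × α) → Bool} {t : ℝ} (ht : 0 < t)
    (hE : ∀ z z', E z z' → t ≤ |kernelStat (collisionKernel c w) z z' - m ^ 2 * τ|) :
    iidExp (fun u : α × α => p u.1 * q u.2) (fun z => iidExp (fun u : α × α => p u.1 * q u.2)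
      fun z' => if E z z' then 1 else 0) ≤
      (m ^ 2 * (32 * B + 8 * τ) + 2 * m ^ 3 * (2 * (τ * (l + B / l + √τ)))) / t ^ 2 := by
  set Δ : Λ → ℝ := fun I => binMass c p I - binMass c q I with hΔ
  have hP := binMass_nonneg (c := c) hp.1
  have hQ := binMass_nonneg (c := c) hq.1
  have hwΔ : ∀ I, 0 ≤ w I * Δ I ^ 2 := fun I => mul_nonneg (hw0 I) (sq_nonneg _)
  -- AM-GM with a free parameter `l` makes the bound linear in `B` instead of in `√B`. This matters
  -- because `B` depends on the random weights and only its expectation will be known.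
  have hwQ : ∀ I, 2 * (w I * binMass c q I) ≤ l + B / l := by
    intro I
    have h1 : (w I * binMass c q I) ^ 2 ≤ B := by
      rw [hB]
      exact Finset.single_le_sum (f := fun I => (w I * binMass c q I) ^ 2)
        (fun I _ => sq_nonneg _) (Finset.mem_univ I)
    have h2 : 2 * (w I * binMass c q I) * l ≤ l * l + B := by
      nlinarith [sq_nonneg (w I * binMass c q I - l)]
    rw [← mul_le_mul_iff_of_pos_right hl]
    rwa [add_mul, div_mul_cancel₀ _ hl.ne']
  have hwΔ2 : ∀ I, (w I * |Δ I|) ^ 2 ≤ w I * Δ I ^ 2 := by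
    intro I
    rw [mul_pow, sq_abs, sq (w I), mul_assoc]
    exact mul_le_of_le_one_left (hwΔ I) (hw1 I)
  have hwΔ1 : ∀ I, w I * |Δ I| ≤ √τ := by
    intro I
    refine Real.le_sqrt_of_sq_le ((hwΔ2 I).trans ?_)
    rw [hτ]
    exact Finset.single_le_sum (f := fun I => w I * Δ I ^ 2) (fun I _ => hwΔ I) (Finset.mem_univ I)
  -- The masses of `p` are removed through `p ≤ q + |Δ|`, so that only collisions of `q` need
  -- control.
  have hPQ : ∀ I, w I * (binMass c p I + binMass c q I) ≤
      2 * (w I * binMass c q I) + w I * |Δ I| := by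
    intro I
    have h1 : binMass c p I + binMass c q I ≤ 2 * binMass c q I + |Δ I| := by
      have := le_abs_self (Δ I)
      simp only [hΔ] at this ⊢
      linarith
    have := mul_le_mul_of_nonneg_left h1 (hw0 I)
    linarith
  have e1 : ∑ I, (binMass c p I + binMass c q I) * (w I * Δ I) ^ 2 ≤ τ * (l + B / l + √τ) := by
    rw [hτ, Finset.sum_mul, ← hτ]
    refine Finset.sum_le_sum fun I _ => ?_
    have : (binMass c p I + binMass c q I) * (w I * Δ I) ^ 2 =
      w I * Δ I ^ 2 * (w I * (binMass c p I + binMass c q I)) := by ring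
    rw [this]
    exact mul_le_mul_of_nonneg_left (by linarith [hPQ I, hwQ I, hwΔ1 I]) (hwΔ I)
  have e2 : ∑ I, (w I * (binMass c p I + binMass c q I)) ^ 2 ≤ 8 * B + 2 * τ := by
    rw [hτ, hB, Finset.mul_sum, Finset.mul_sum, ← Finset.sum_add_distrib]
    refine Finset.sum_le_sum fun I _ => ?_
    have h1 := pow_le_pow_left₀ (mul_nonneg (hw0 I) (add_nonneg (hP I) (hQ I))) (hPQ I) 2
    have h2 := hwΔ2 I
    nlinarith [sq_nonneg (2 * (w I * binMass c q I) - w I * |Δ I|)]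
  have hmean := sum_sum_collisionKernel (c := c) (w := w) hp hq
  rw [← hτ] at hmean
  refine (iidExp_kernelStat_deviation_le (h := collisionKernel c w) (prodLaw_mem_stdSimplex hp hq)
    collisionKernel_symm ht (by rw [hmean]; exact hE)).trans ?_
  have h1 := sum_sum_sq_collisionKernel_le (c := c) (w := w) hp hq
  have h2 := sum_sq_sum_collisionKernel_le (c := c) (w := w) hp hq
  gcongr
  · linarith
  · linarith

end collision

/-! ### Weights that split heavy bins -/

/-- Exchangeability: among `a + 1` draws, the shares `1_E (s i) / count` sum to at most `1` and have
equal expectations, namely the left-hand side. -/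
lemma mul_iidExp_inv_count_le {α : Type*} [Fintype α] {q : α → ℝ} (hq : q ∈ stdSimplex ℝ α)
    (E : α → Prop) [DecidablePred E] (a : ℕ) :
    (∑ x, q x * if E x then 1 else 0) *
      iidExp q (fun A : Fin a → α => 1 / (1 + ∑ j, if E (A j) then (1 : ℝ) else 0)) ≤
      1 / (a + 1) := by
  set X := iidExp q (fun A : Fin a → α => 1 / (1 + ∑ j, if E (A j) then (1 : ℝ) else 0)) with hX
  have h1 : ∀ i : Fin (a + 1), iidExp q (fun s : Fin (a + 1) → α =>
      (if E (s i) then (1 : ℝ) else 0) / ∑ j, if E (s j) then (1 : ℝ) else 0) =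
      (∑ x, q x * if E x then 1 else 0) * X := by
    intro i
    -- Splitting off coordinate `i` leaves `a` independent draws; when `E` holds at `i`, the count
    -- is one plus theirs.
    rw [hX, iidExp, ← (Fin.insertNthEquiv (fun _ => α) i).sum_comp, Fintype.sum_prod_type,
      Finset.sum_mul]
    refine Finset.sum_congr rfl fun x _ => ?_
    rw [iidExp, Finset.mul_sum]
    refine Finset.sum_congr rfl fun t _ => ?_
    rw [Fin.prod_univ_succAbove _ i, Fin.sum_univ_succAbove _ i]
    simp only [Fin.insertNthEquiv_apply, Fin.insertNth_apply_same, Fin.insertNth_apply_succAbove]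
    split_ifs <;> ring
  have h2 : iidExp q (fun s : Fin (a + 1) → α =>
      ∑ i, (if E (s i) then (1 : ℝ) else 0) / ∑ j, if E (s j) then (1 : ℝ) else 0) ≤ 1 := by
    refine (iidExp_mono hq.1 fun s => ?_).trans (iidExp_const hq 1).le
    rw [← Finset.sum_div]
    exact div_self_le_one _
  rw [iidExp_sum] at h2
  simp only [h1, Finset.sum_const, Finset.card_univ, Fintype.card_fin, nsmul_eq_mul] at h2
  rw [le_div_iff₀' (by positivity)]
  exact_mod_cast h2

section weight

variable {α Λ : Type*} [DecidableEq Λ] {a : ℕ}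

/-- The weight of a bin, the inverse of one plus the number of points of `A` in it. -/
noncomputable def binWeight (c : α → Λ) (A : Fin a → α) (I : Λ) : ℝ :=
  1 / (1 + ∑ j, if c (A j) = I then 1 else 0)

lemma one_le_one_add_count (c : α → Λ) (A : Fin a → α) (I : Λ) :
    (1 : ℝ) ≤ 1 + ∑ j, if c (A j) = I then 1 else 0 :=
  le_add_of_nonneg_right (Finset.sum_nonneg fun j _ => by split_ifs <;> norm_num)

lemma binWeight_pos (c : α → Λ) (A : Fin a → α) (I : Λ) : 0 < binWeight c A I :=
  div_pos one_pos (one_pos.trans_le (one_le_one_add_count c A I))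

lemma binWeight_le_one (c : α → Λ) (A : Fin a → α) (I : Λ) : binWeight c A I ≤ 1 :=
  (div_le_one (one_pos.trans_le (one_le_one_add_count c A I))).2 (one_le_one_add_count c A I)

/-- Cauchy-Schwarz, since the inverse weights sum to the number of bins plus `a`. -/
lemma sq_sum_abs_le_binWeight [Fintype Λ] (c : α → Λ) (A : Fin a → α) (Δ : Λ → ℝ) :
    (∑ I, |Δ I|) ^ 2 ≤ (∑ I, binWeight c A I * Δ I ^ 2) * (Fintype.card Λ + a) := by
  have h1 : ∑ I, 1 / binWeight c A I = Fintype.card Λ + a := by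
    simp only [binWeight, one_div_one_div, Finset.sum_add_distrib]
    rw [Finset.sum_comm]
    simp
  rw [← h1]
  refine Finset.sum_sq_le_sum_mul_sum_of_sq_le_mul _
    (fun I _ => mul_nonneg (binWeight_pos c A I).le (sq_nonneg _))
    (fun I _ => one_div_nonneg.2 (binWeight_pos c A I).le) fun I _ => le_of_eq ?_
  rw [sq_abs, mul_right_comm, mul_one_div_cancel (binWeight_pos c A I).ne', one_mul]

/-- Since `w ^ 2 ≤ w`, one factor of the bin mass is absorbed by `mul_iidExp_inv_count_le` and the
remaining factors sum to `1`. -/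
lemma iidExp_sum_sq_binWeight_le [Fintype α] [Fintype Λ] {q : α → ℝ} (hq : q ∈ stdSimplex ℝ α) (c : α → Λ) :
    iidExp q (fun A : Fin a → α => ∑ I, (binWeight c A I * binMass c q I) ^ 2) ≤ 1 / (a + 1) := by
  have hQ := binMass_nonneg (c := c) hq.1
  have hQ1 : ∑ I, binMass c q I = 1 := by
    rw [← hq.2]
    exact Finset.sum_fiberwise _ _ _
  calc _ ≤ iidExp q (fun A : Fin a → α => ∑ I, binMass c q I ^ 2 * binWeight c A I) := by
        refine iidExp_mono hq.1 fun A => Finset.sum_le_sum fun I _ => ?_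
        rw [mul_pow, mul_comm]
        refine mul_le_mul_of_nonneg_left ?_ (sq_nonneg _)
        exact pow_le_of_le_one (binWeight_pos c A I).le (binWeight_le_one c A I) two_ne_zero
    _ = ∑ I, binMass c q I * (binMass c q I * iidExp q fun A : Fin a → α => binWeight c A I) := by
        rw [iidExp_sum]
        refine Finset.sum_congr rfl fun I _ => ?_
        rw [iidExp_mul_left]; ring
    _ ≤ ∑ I, binMass c q I * (1 / (a + 1)) := by
        refine Finset.sum_le_sum fun I _ => mul_le_mul_of_nonneg_left ?_ (hQ I)
        have := mul_iidExp_inv_count_le hq (fun x => c x = I) a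
        rwa [sum_mul_ite_bin, mul_one] at this
    _ = 1 / (a + 1) := by rw [← Finset.sum_mul, hQ1, one_mul]

end weight

/-! ### The tester -/

section tester

variable {n s a m : ℕ}

/-- Accept if the collision statistic, for the partition induced by `S` and the weights induced by
`A`, is below `θ`. -/
noncomputable def collisionTest (η θ : ℝ) (S : Fin s → Fin n) (A : Fin a → Fin n)
    (z z' : Fin m → Fin n × Fin n) : Bool :=
  decide (kernelStat (collisionKernel (binLabel S η) (binWeight (binLabel S η) A)) z z' < θ)

/-- The expectation over the samples of `collisionTest`. -/
noncomputable def testExp (p q : Fin n → ℝ)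
    (F : (Fin s → Fin n) → (Fin a → Fin n) → (Fin m → Fin n × Fin n) → (Fin m → Fin n × Fin n) → ℝ) :
    ℝ :=
  iidExp q fun S => iidExp q fun A => iidExp (fun u : Fin n × Fin n => p u.1 * q u.2) fun z =>
    iidExp (fun u : Fin n × Fin n => p u.1 * q u.2) fun z' => F S A z z'

/-- Completeness. When `p = q` the mean is `0` and only the collision term of the variance survives;
averaging over `A` gives `128 / (m * τ₀ * √(a + 1)) ^ 2`. -/
lemma testExp_collisionTest_self_le {p : Fin n → ℝ} (hp : p ∈ stdSimplex ℝ (Fin n)) (η : ℝ)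
    {τ₀ : ℝ} (hτ₀ : 0 < τ₀) (hm : 1600 ≤ m * τ₀ * √(a + 1)) :
    testExp p p (fun (S : Fin s → Fin n) (A : Fin a → Fin n) (z z' : Fin m → Fin n × Fin n) =>
      if collisionTest η (m ^ 2 * τ₀ / 2) S A z z' then 0 else 1) ≤ 1 / 16 := by
  have hm0 : (0 : ℝ) < m := by
    rcases Nat.eq_zero_or_pos m with h | h
    · rw [h] at hm; norm_num at hm
    · exact_mod_cast h
  have hθ : 0 < m ^ 2 * τ₀ / 2 := by positivity
  have hX : (1600 : ℝ) ^ 2 ≤ (m * τ₀) ^ 2 * (a + 1) := by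
    have := pow_le_pow_left₀ (by norm_num) hm 2
    rwa [mul_pow (m * τ₀), Real.sq_sqrt (by positivity)] at this
  have key : ∀ (S : Fin s → Fin n) (A : Fin a → Fin n),
      iidExp (fun u : Fin n × Fin n => p u.1 * p u.2) (fun z : Fin m → Fin n × Fin n =>
        iidExp (fun u : Fin n × Fin n => p u.1 * p u.2) fun z' : Fin m → Fin n × Fin n =>
          if collisionTest η (m ^ 2 * τ₀ / 2) S A z z' then 0 else 1) ≤
      128 / (m * τ₀) ^ 2 *
        ∑ I, (binWeight (binLabel S η) A I * binMass (binLabel S η) p I) ^ 2 := by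
    intro S A
    have h := iidExp_collision_deviation_le (c := binLabel S η) (w := binWeight (binLabel S η) A)
      (τ := 0) (l := 1) (m := m) (t := m ^ 2 * τ₀ / 2)
      (E := fun z z' => !collisionTest η (m ^ 2 * τ₀ / 2) S A z z') hp hp
      (fun I => (binWeight_pos _ A I).le) (binWeight_le_one _ A) (by simp) rfl one_pos hθ
      (by
        intro z z' hz
        simp only [collisionTest, Bool.not_eq_true', decide_eq_false_iff_not, not_lt] at hz
        rw [mul_zero, sub_zero]
        exact hz.trans (le_abs_self _))
    refine le_trans (le_of_eq ?_) (h.trans (le_of_eq ?_))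
    · congr 1; ext z; congr 1; ext z'
      cases collisionTest η (m ^ 2 * τ₀ / 2) S A z z' <;> simp
    · simp only [mul_zero, add_zero, zero_mul]
      field_simp
      ring
  calc _ ≤ iidExp p fun S : Fin s → Fin n => iidExp p fun A : Fin a → Fin n =>
        128 / (m * τ₀) ^ 2 *
          ∑ I, (binWeight (binLabel S η) A I * binMass (binLabel S η) p I) ^ 2 :=
        iidExp_mono hp.1 fun S => iidExp_mono hp.1 fun A => key S A
    _ ≤ iidExp p fun S : Fin s → Fin n => 128 / (m * τ₀) ^ 2 * (1 / (a + 1)) := by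
        refine iidExp_mono hp.1 fun S => ?_
        rw [iidExp_mul_left]
        exact mul_le_mul_of_nonneg_left (iidExp_sum_sq_binWeight_le hp _) (by positivity)
    _ = 128 / ((m * τ₀) ^ 2 * (a + 1)) := by
        rw [iidExp_const hp, div_mul_div_comm, mul_one]
    _ ≤ 128 / 1600 ^ 2 := by gcongr
    _ ≤ 1 / 16 := by norm_num

/-- Relative to the threshold `μ ^ 2 * τ / 2`, every variance term decreases in `τ`, so `τ` may be
replaced by its lower bound `τ₀`. -/
lemma deviation_bound_le {B τ τ₀ l μ : ℝ} (hB : 0 ≤ B) (hτ₀ : 0 < τ₀) (hτ : τ₀ ≤ τ) (hl : 0 < l)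
    (hμ : 0 < μ) :
    (μ ^ 2 * (32 * B + 8 * τ) + 2 * μ ^ 3 * (2 * (τ * (l + B / l + √τ)))) / (μ ^ 2 * τ / 2) ^ 2 ≤
      (128 / (μ * τ₀) ^ 2 + 16 / (l * (μ * τ₀))) * B +
        (32 / (μ * √τ₀) ^ 2 + 16 * l / (μ * τ₀) + 16 / (μ * √τ₀)) := by
  have hτ' := hτ₀.trans_le hτ
  have e : (μ ^ 2 * (32 * B + 8 * τ) + 2 * μ ^ 3 * (2 * (τ * (l + B / l + √τ)))) /
      (μ ^ 2 * τ / 2) ^ 2 = (128 / (μ * τ) ^ 2 + 16 / (l * (μ * τ))) * B +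
        (32 / (μ * √τ) ^ 2 + 16 * l / (μ * τ) + 16 / (μ * √τ)) := by
    have h1 : 16 / (μ * √τ) = 16 * √τ / (μ * τ) := by
      have : τ = √τ * √τ := (Real.mul_self_sqrt hτ'.le).symm
      have h0 := Real.sqrt_pos.2 hτ'
      rw [div_eq_div_iff (by positivity) (by positivity)]
      nlinarith
    rw [mul_pow μ (√τ), Real.sq_sqrt hτ'.le, h1]
    field_simp
    ring
  rw [e]
  gcongr

/-- Soundness. The constant `512` limits the cost of bad partitions to `1 / 32`, and `1600` keeps
the variance terms at just over `3 / 100`; together they stay below `1 / 16`. -/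
lemma testExp_collisionTest_le {p q : ProbDist n} {k : ℕ} (hp : IsKModal k p) (hq : IsKModal k q)
    {ε η τ₀ : ℝ} (hε : 0 < ε) (hε1 : ε ≤ 1) (hη : η = ε / 16) (hpq : ε ≤ tvDist p q)
    (hs : 512 * k ≤ (s + 1) * ε)
    (hτ₀ : τ₀ = (ε / 2) ^ 2 / (Fintype.card (BinLabel n s η) + a))
    (hm : 1600 ≤ m * τ₀ * √(a + 1)) :
    testExp p.1 q.1 (fun (S : Fin s → Fin n) (A : Fin a → Fin n) (z z' : Fin m → Fin n × Fin n) =>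
      if collisionTest η (m ^ 2 * τ₀ / 2) S A z z' then 1 else 0) ≤ 1 / 16 := by
  have hm0 : (0 : ℝ) < m := by
    rcases Nat.eq_zero_or_pos m with h | h
    · rw [h] at hm; norm_num at hm
    · exact_mod_cast h
  have hcard : (1 : ℝ) ≤ Fintype.card (BinLabel n s η) := by
    exact_mod_cast Fintype.card_pos_iff.2 ⟨((0 : Fin (s + 1)), none)⟩
  have hτpos : 0 < τ₀ := by rw [hτ₀]; positivity
  -- The square root of the bound on the expectation of `B`, which balances `l` against `B / l`.
  set l : ℝ := 1 / √(a + 1) with hl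
  have hr : 0 < √((a : ℝ) + 1) := Real.sqrt_pos.2 (by positivity)
  have hlpos : 0 < l := by positivity
  obtain ⟨M, hMc, hM⟩ := hp.exists_modes
  obtain ⟨M', hMc', hM'⟩ := hq.exists_modes
  have hMp : ∀ J : Set (Fin n), J.OrdConnected → Disjoint J (M ∪ M' : Finset (Fin n)) →
      MonotoneOn p.1 J ∨ AntitoneOn p.1 J := fun J hJ hd =>
    hM J hJ (hd.mono_right (by simp))
  have hMq : ∀ J : Set (Fin n), J.OrdConnected → Disjoint J (M ∪ M' : Finset (Fin n)) →
      MonotoneOn q.1 J ∨ AntitoneOn q.1 J := fun J hJ hd =>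
    hM' J hJ (hd.mono_right (by simp))
  set bad : (Fin s → Fin n) → ℝ := fun S => ∑ x ∈ badPoints S (M ∪ M'), q.1 x with hbad
  have hbad0 : ∀ S, 0 ≤ bad S := fun S => Finset.sum_nonneg fun x _ => q.2.1 x
  have hpq' : 2 * ε ≤ ∑ x, |p.1 x - q.1 x| := by
    simp only [tvDist] at hpq
    linarith
  have hη0 : 0 < η := by rw [hη]; positivity
  -- With `η = ε / 16` flattening costs `ε / 4` for each distribution, so the partition inequality
  -- reads `2 * ε ≤ 2 * ∑ I, |Δ I| + ε / 2 + ε / 2`.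
  have hΔ : ∀ S : Fin s → Fin n, bad S ≤ ε / 4 →
      ε / 2 ≤ ∑ I, |binMass (binLabel S η) p.1 I - binMass (binLabel S η) q.1 I| := by
    intro S hS
    have hη1 : η ≤ 1 / 2 := by rw [hη]; linarith
    have h1 := sum_abs_sub_binAverage_le p.2.1 hMp S hη0 hη1
    have h2 := sum_abs_sub_binAverage_le q.2.1 hMq S hη0 hη1
    rw [p.2.2] at h1
    rw [q.2.2] at h2
    have h3 := sum_abs_sub_le_of_partition (binLabel S η) p.2.1 q.2.1 (badPoints S (M ∪ M'))
      (fun x hx y hy => mem_badPoints_of_binLabel_eq hx hy) h1 h2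
    have e : ∑ I, |binMass (binLabel S η) p.1 I - binMass (binLabel S η) q.1 I| =
      ∑ I, |∑ y with binLabel S η y = I, p.1 y - ∑ y with binLabel S η y = I, q.1 y| := rfl
    rw [← e] at h3
    simp only [hbad] at hS
    rw [hη] at h3 ⊢
    linarith
  set C₁ : ℝ := 128 / (m * τ₀) ^ 2 + 16 / (l * (m * τ₀)) with hC₁
  set C₂ : ℝ := 32 / (m * √τ₀) ^ 2 + 16 * l / (m * τ₀) + 16 / (m * √τ₀) with hC₂
  have hC₁0 : 0 ≤ C₁ := by positivity
  have hC₂0 : 0 ≤ C₂ := by positivity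
  set ρ : Fin n × Fin n → ℝ := fun u => p.1 u.1 * q.1 u.2 with hρdef
  have hρ : ρ ∈ stdSimplex ℝ (Fin n × Fin n) := prodLaw_mem_stdSimplex p.2 q.2
  have key : ∀ (S : Fin s → Fin n) (A : Fin a → Fin n),
      iidExp ρ (fun z : Fin m → Fin n × Fin n => iidExp ρ fun z' : Fin m → Fin n × Fin n =>
          if collisionTest η (m ^ 2 * τ₀ / 2) S A z z' then 1 else 0) ≤
      (C₁ * ∑ I, (binWeight (binLabel S η) A I * binMass (binLabel S η) q.1 I) ^ 2)
        + (C₂ + 4 / ε * bad S) := by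
    intro S A
    set B := ∑ I, (binWeight (binLabel S η) A I * binMass (binLabel S η) q.1 I) ^ 2 with hB
    have hB0 : 0 ≤ B := Finset.sum_nonneg fun I _ => sq_nonneg _
    rcases le_or_gt (bad S) (ε / 4) with hS | hS
    · set τ := ∑ I, binWeight (binLabel S η) A I *
        (binMass (binLabel S η) p.1 I - binMass (binLabel S η) q.1 I) ^ 2 with hτ
      have hττ₀ : τ₀ ≤ τ := by
        rw [hτ₀, div_le_iff₀ (by positivity)]
        exact (pow_le_pow_left₀ (by positivity) (hΔ S hS) 2).trans (sq_sum_abs_le_binWeight _ A _)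
      have hτ' := hτpos.trans_le hττ₀
      have h := iidExp_collision_deviation_le (c := binLabel S η)
        (w := binWeight (binLabel S η) A) (τ := τ) (l := l) (m := m) (t := m ^ 2 * τ / 2)
        (E := fun z z' => collisionTest η (m ^ 2 * τ₀ / 2) S A z z') p.2 q.2
        (fun I => (binWeight_pos _ A I).le) (binWeight_le_one _ A) hτ rfl hlpos (by positivity)
        (by
          intro z z' hz
          simp only [collisionTest, decide_eq_true_eq] at hz
          have h1 : (m : ℝ) ^ 2 * τ₀ ≤ m ^ 2 * τ := by gcongr
          rw [abs_sub_comm]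
          refine le_trans ?_ (le_abs_self _)
          linarith)
      refine h.trans ((deviation_bound_le hB0 hτpos hττ₀ hlpos hm0).trans ?_)
      have : 0 ≤ 4 / ε * bad S := mul_nonneg (by positivity) (hbad0 S)
      linarith
    -- For a bad partition the trivial bound `1` is at most `4 / ε * bad S`: Markov's inequality is
    -- built into the pointwise bound.
    · have h1 : iidExp ρ (fun z : Fin m → Fin n × Fin n => iidExp ρ fun z' : Fin m → Fin n × Fin n =>
          if collisionTest η (m ^ 2 * τ₀ / 2) S A z z' then (1 : ℝ) else 0) ≤ 1 := by
        refine (iidExp_mono hρ.1 fun z => iidExp_mono hρ.1 (g := fun _ => 1) fun z' => ?_).trans ?_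
        · split_ifs <;> norm_num
        · rw [iidExp_const hρ, iidExp_const hρ]
      have h2 : 1 ≤ 4 / ε * bad S := by
        rw [div_mul_eq_mul_div, le_div_iff₀ hε]
        linarith
      have h3 := mul_nonneg hC₁0 hB0
      linarith
  have hXpos : 0 < m * τ₀ * √(a + 1) := by linarith
  have hC₁le : C₁ * (1 / (a + 1)) ≤ 128 / 1600 ^ 2 + 16 / 1600 := by
    have e : C₁ * (1 / (a + 1)) =
        128 / (m * τ₀ * √(a + 1)) ^ 2 + 16 / (m * τ₀ * √(a + 1)) := by
      have h1 : (a : ℝ) + 1 = √(a + 1) ^ 2 := (Real.sq_sqrt (by positivity)).symm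
      rw [hC₁, hl]
      generalize √((a : ℝ) + 1) = r at *
      rw [h1]
      field_simp
    rw [e]
    gcongr
  have hC₂le : C₂ ≤ 32 / 1600 ^ 2 + 16 / 1600 + 16 / 1600 := by
    -- Since `τ₀ * (a + 1) ≤ 1`, this is implied by the condition on `m * τ₀ * √(a + 1)`.
    have h1 : 1600 ≤ m * √τ₀ := by
      have h2 : √τ₀ * √(a + 1) ≤ 1 := by
        rw [← Real.sqrt_mul hτpos.le, Real.sqrt_le_one, hτ₀, div_mul_eq_mul_div,
          div_le_one (by positivity)]
        have h3 : (ε / 2) ^ 2 ≤ 1 := pow_le_one₀ (by positivity) (by linarith)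
        have h4 : (ε / 2) ^ 2 * ((a : ℝ) + 1) ≤ a + 1 := mul_le_of_le_one_left (by positivity) h3
        linarith
      have h3 : m * τ₀ * √(a + 1) = m * √τ₀ * (√τ₀ * √(a + 1)) := by
        conv_lhs => rw [← Real.mul_self_sqrt hτpos.le]
        ring
      rw [h3] at hm
      exact hm.trans (mul_le_of_le_one_right (by positivity) h2)
    have e : 16 * l / (m * τ₀) = 16 / (m * τ₀ * √(a + 1)) := by
      rw [hl]; field_simp
    rw [hC₂, e]
    gcongr
  have hbadE : iidExp q.1 bad ≤ ε / 128 := by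
    refine (iidExp_mass_badPoints_le q.2 (M ∪ M')).trans ?_
    have h1 : ((M ∪ M').card : ℝ) ≤ 2 * k := by
      exact_mod_cast (Finset.card_union_le M M').trans (by omega)
    rw [← mul_div_assoc, div_le_iff₀ (by positivity)]
    linarith
  calc _ ≤ iidExp q.1 fun S : Fin s → Fin n => iidExp q.1 fun A : Fin a → Fin n =>
        (C₁ * ∑ I, (binWeight (binLabel S η) A I * binMass (binLabel S η) q.1 I) ^ 2)
        + (C₂ + 4 / ε * bad S) :=
        iidExp_mono q.2.1 fun S => iidExp_mono q.2.1 fun A => key S A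
    _ ≤ iidExp q.1 fun S : Fin s → Fin n => (C₁ * (1 / (a + 1)) + C₂) + 4 / ε * bad S := by
        refine iidExp_mono q.2.1 fun S => ?_
        rw [iidExp_add, iidExp_const q.2, iidExp_mul_left, ← add_assoc]
        gcongr
        exact iidExp_sum_sq_binWeight_le q.2 _
    _ ≤ (128 / 1600 ^ 2 + 16 / 1600) + (32 / 1600 ^ 2 + 16 / 1600 + 16 / 1600)
        + 4 / ε * (ε / 128) := by
        rw [iidExp_add, iidExp_const q.2, iidExp_mul_left]
        gcongr
    _ ≤ 1 / 16 := by
        have : 4 / ε * (ε / 128) = 1 / 32 := by field_simp; norm_num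
        rw [this]
        norm_num

end tester

/-! ### Testers with amplified success probability -/

lemma KnownTester.acceptProb_eq {n m : ℕ} (T : KnownTester n m) (p q : ProbDist n) :
    T.acceptProb p q = iidExp p.1 fun s => (T q s : ℝ) := rfl

lemma KnownTester.rejectProb_eq {n m : ℕ} (T : KnownTester n m) (p q : ProbDist n) :
    T.rejectProb p q = iidExp p.1 fun s => 1 - (T q s : ℝ) := rfl

lemma UnknownTester.acceptProb_eq {n m : ℕ} (T : UnknownTester n m) (p q : ProbDist n) :
    T.acceptProb p q = iidExp p.1 fun s => iidExp q.1 fun t => (T s t : ℝ) := by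
  simp only [UnknownTester.acceptProb, iidExp, sampleProb, Finset.mul_sum, mul_assoc]

lemma UnknownTester.rejectProb_eq {n m : ℕ} (T : UnknownTester n m) (p q : ProbDist n) :
    T.rejectProb p q = iidExp p.1 fun s => iidExp q.1 fun t => 1 - (T s t : ℝ) := by
  simp only [UnknownTester.rejectProb, iidExp, sampleProb, Finset.mul_sum, mul_assoc]

/-- The answer `b` as an acceptance probability. -/
def Bool.toUnitInterval (b : Bool) : unitInterval := if b then 1 else 0

lemma Bool.coe_toUnitInterval (b : Bool) : (b.toUnitInterval : ℝ) = 1 - if b then 0 else 1 := by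
  cases b <;> simp [Bool.toUnitInterval]

lemma Bool.one_sub_coe_toUnitInterval (b : Bool) :
    1 - (b.toUnitInterval : ℝ) = 1 - if b then 1 else 0 := by
  cases b <;> simp [Bool.toUnitInterval]

section

variable {n s a m : ℕ}

/-- With the draws from `p` outermost, the inner expectation over `q` can be computed by a tester
that knows `q`. -/
lemma testExp_eq_iidExp_left (p q : Fin n → ℝ)
    (F : (Fin s → Fin n) → (Fin a → Fin n) → (Fin m → Fin n × Fin n) → (Fin m → Fin n × Fin n) → ℝ) :
    testExp p q F = iidExp p fun x : Fin m → Fin n => iidExp p fun x' : Fin m → Fin n =>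
      iidExp q fun S => iidExp q fun A => iidExp q fun y : Fin m → Fin n =>
        iidExp q fun y' : Fin m → Fin n => F S A (fun i => (x i, y i)) fun i => (x' i, y' i) := by
  simp only [testExp, iidExp_prodLaw]
  have h1 : ∀ S A (x : Fin m → Fin n), iidExp q (fun y : Fin m → Fin n =>
      iidExp p fun x' : Fin m → Fin n => iidExp q fun y' : Fin m → Fin n =>
        F S A (fun i => (x i, y i)) fun i => (x' i, y' i)) =
      iidExp p (fun x' : Fin m → Fin n => iidExp q fun y : Fin m → Fin n =>
        iidExp q fun y' : Fin m → Fin n =>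
          F S A (fun i => (x i, y i)) fun i => (x' i, y' i)) := fun S A x => iidExp_comm _
  simp only [h1]
  have h2 : ∀ S, iidExp q (fun A => iidExp p fun x : Fin m → Fin n => iidExp p
      fun x' : Fin m → Fin n => iidExp q fun y : Fin m → Fin n => iidExp q
        fun y' : Fin m → Fin n => F S A (fun i => (x i, y i)) fun i => (x' i, y' i)) =
      iidExp p fun x : Fin m → Fin n => iidExp p fun x' : Fin m → Fin n => iidExp q
        fun A => iidExp q fun y : Fin m → Fin n => iidExp q
        fun y' : Fin m → Fin n => F S A (fun i => (x i, y i)) fun i => (x' i, y' i) := by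
    intro S
    rw [iidExp_comm]
    congr 1; ext x
    exact iidExp_comm _
  simp only [h2]
  rw [iidExp_comm]
  congr 1; ext x
  exact iidExp_comm _

lemma iidExp_snd {ι α β : Type*} [Fintype ι] [DecidableEq ι] [Fintype α] [Fintype β] {p : α → ℝ}
    {q : β → ℝ} (hp : p ∈ stdSimplex ℝ α) (F : (ι → β) → ℝ) :
    iidExp (fun u : α × β => p u.1 * q u.2) (fun z : ι → α × β => F fun i => (z i).2) =
      iidExp q F := by
  rw [iidExp_prodLaw]
  exact iidExp_const (ι := ι) hp (iidExp q F)

/-- One block of paired samples feeds the whole test; for the partition and the weights the `p`-half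
of each pair is discarded. -/
lemma testExp_eq_iidExp_pairs {p q : Fin n → ℝ} (hp : p ∈ stdSimplex ℝ (Fin n))
    (F : (Fin s → Fin n) → (Fin a → Fin n) → (Fin m → Fin n × Fin n) → (Fin m → Fin n × Fin n) → ℝ) :
    iidExp (fun u : Fin n × Fin n => p u.1 * q u.2)
      (fun b : Fin s ⊕ Fin a ⊕ Fin m ⊕ Fin m → Fin n × Fin n =>
        F (fun i => (b (.inl i)).2) (fun i => (b (.inr (.inl i))).2)
          (fun i => b (.inr (.inr (.inl i)))) (fun i => b (.inr (.inr (.inr i))))) =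
      testExp p q F := by
  simp only [iidExp_sumElim (ι := Fin s), iidExp_sumElim (ι := Fin a), iidExp_sumElim (ι := Fin m),
    Sum.elim_inl, Sum.elim_inr]
  rw [testExp, iidExp_snd hp fun S => iidExp (fun u : Fin n × Fin n => p u.1 * q u.2) fun A =>
    iidExp (fun u : Fin n × Fin n => p u.1 * q u.2) fun z =>
    iidExp (fun u : Fin n × Fin n => p u.1 * q u.2) fun z' => F S (fun i => (A i).2) z z']
  congr 1; ext S
  exact iidExp_snd hp fun A => iidExp (fun u : Fin n × Fin n => p u.1 * q u.2) fun z =>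
    iidExp (fun u : Fin n × Fin n => p u.1 * q u.2) fun z' => F S A z z'

/-- Only the `2 * m` draws from `p` are charged. The acceptance probability over the simulated draws
from `q` is computed exactly and rounded. -/
lemma exists_knownTester (n k s a m r : ℕ) {ε τ₀ : ℝ} (hε : 0 < ε) (hε1 : ε ≤ 1)
    (hs : 512 * k ≤ (s + 1) * ε)
    (hτ₀ : τ₀ = (ε / 2) ^ 2 / (Fintype.card (BinLabel n s (ε / 16)) + a))
    (hm : 1600 ≤ m * τ₀ * √(a + 1)) :
    ∃ T : KnownTester n (r * Fintype.card (Fin m ⊕ Fin m)), ∀ p q : ProbDist n,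
      IsKModal k p → IsKModal k q →
        (p = q → 1 - (2 / 3) ^ r ≤ T.acceptProb p q) ∧
        (ε ≤ tvDist p q → 1 - (2 / 3) ^ r ≤ T.rejectProb p q) := by
  have hτpos : 0 < τ₀ := by
    rcases lt_or_ge 0 τ₀ with h | h
    · exact h
    · have := mul_nonpos_of_nonpos_of_nonneg
        (mul_nonpos_of_nonneg_of_nonpos (Nat.cast_nonneg (α := ℝ) m) h) (Real.sqrt_nonneg (a + 1))
      linarith
  let f : ProbDist n → (Fin m ⊕ Fin m → Fin n) → ℝ := fun q b =>
    iidExp q.1 fun S : Fin s → Fin n => iidExp q.1 fun A : Fin a → Fin n =>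
      iidExp q.1 fun y : Fin m → Fin n => iidExp q.1 fun y' : Fin m → Fin n =>
        if collisionTest (ε / 16) (m ^ 2 * τ₀ / 2) S A (fun i => (b (.inl i), y i))
          (fun i => (b (.inr i), y' i)) then 1 else 0
  let g : ProbDist n → (Fin m ⊕ Fin m → Fin n) → ℝ := fun q b =>
    iidExp q.1 fun S : Fin s → Fin n => iidExp q.1 fun A : Fin a → Fin n =>
      iidExp q.1 fun y : Fin m → Fin n => iidExp q.1 fun y' : Fin m → Fin n =>
        if collisionTest (ε / 16) (m ^ 2 * τ₀ / 2) S A (fun i => (b (.inl i), y i))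
          (fun i => (b (.inr i), y' i)) then 0 else 1
  have hf0 : ∀ q b, 0 ≤ f q b := fun q b => by
    refine iidExp_nonneg q.2.1 fun S => iidExp_nonneg q.2.1 fun A => iidExp_nonneg q.2.1 fun y =>
      iidExp_nonneg q.2.1 fun y' => ?_
    split_ifs <;> norm_num
  have hg0 : ∀ q b, 0 ≤ g q b := fun q b => by
    refine iidExp_nonneg q.2.1 fun S => iidExp_nonneg q.2.1 fun A => iidExp_nonneg q.2.1 fun y =>
      iidExp_nonneg q.2.1 fun y' => ?_
    split_ifs <;> norm_num
  have hfg : ∀ q b, f q b + g q b = 1 := fun q b => by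
    simp only [f, g, ← iidExp_add]
    have : ∀ t : Bool, (if t then (1 : ℝ) else 0) + (if t then 0 else 1) = 1 := by
      intro t; cases t <;> simp
    simp only [this, iidExp_const q.2]
  -- Rounding at `1 / 2` at most doubles the error, from `1 / 16` to the `1 / 8` needed for
  -- amplification.
  choose D hD using fun q : ProbDist n => exists_amplified_test (fun b => decide (1 / 2 ≤ f q b)) r
  refine ⟨fun q s => (D q s).toUnitInterval, fun p q hp hq => ⟨?_, fun hpq => ?_⟩⟩
  · rintro rfl
    rw [KnownTester.acceptProb_eq]
    simp only [Bool.coe_toUnitInterval, iidExp_sub, iidExp_const p.2]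
    refine sub_le_sub_left ((hD p p.1 p.2).2 ?_) 1
    have h := testExp_collisionTest_self_le (s := s) p.2 (ε / 16) hτpos hm
    rw [testExp_eq_iidExp_left] at h
    have h1 : iidExp p.1 (g p) ≤ 1 / 16 := by
      rw [iidExp_sumElim]
      exact h
    calc _ ≤ iidExp p.1 (fun b => 2 * g p b) := by
          refine iidExp_mono p.2.1 fun b => ?_
          simp only [decide_eq_true_eq]
          split_ifs with hb
          · linarith [hg0 p b]
          · linarith [hfg p b]
      _ ≤ 1 / 8 := by rw [iidExp_mul_left]; linarith
  · rw [KnownTester.rejectProb_eq]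
    simp only [Bool.one_sub_coe_toUnitInterval, iidExp_sub, iidExp_const p.2]
    refine sub_le_sub_left ((hD q p.1 p.2).1 ?_) 1
    have h := testExp_collisionTest_le hp hq hε hε1 rfl hpq hs hτ₀ hm
    rw [testExp_eq_iidExp_left] at h
    have h1 : iidExp p.1 (f q) ≤ 1 / 16 := by
      rw [iidExp_sumElim]
      exact h
    calc _ ≤ iidExp p.1 (fun b => 2 * f q b) := by
          refine iidExp_mono p.2.1 fun b => ?_
          simp only [decide_eq_true_eq]
          split_ifs with hb
          · linarith
          · linarith [hf0 q b]
      _ ≤ 1 / 8 := by rw [iidExp_mul_left]; linarith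

lemma exists_unknownTester (n k s a m r : ℕ) {ε τ₀ : ℝ} (hε : 0 < ε) (hε1 : ε ≤ 1)
    (hs : 512 * k ≤ (s + 1) * ε)
    (hτ₀ : τ₀ = (ε / 2) ^ 2 / (Fintype.card (BinLabel n s (ε / 16)) + a))
    (hm : 1600 ≤ m * τ₀ * √(a + 1)) :
    ∃ T : UnknownTester n (r * Fintype.card (Fin s ⊕ Fin a ⊕ Fin m ⊕ Fin m)), ∀ p q : ProbDist n,
      IsKModal k p → IsKModal k q →
        (p = q → 1 - (2 / 3) ^ r ≤ T.acceptProb p q) ∧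
        (ε ≤ tvDist p q → 1 - (2 / 3) ^ r ≤ T.rejectProb p q) := by
  have hτpos : 0 < τ₀ := by
    rcases lt_or_ge 0 τ₀ with h | h
    · exact h
    · have := mul_nonpos_of_nonpos_of_nonneg
        (mul_nonpos_of_nonneg_of_nonpos (Nat.cast_nonneg (α := ℝ) m) h) (Real.sqrt_nonneg (a + 1))
      linarith
  obtain ⟨D, hD⟩ := exists_amplified_test
    (fun b : Fin s ⊕ Fin a ⊕ Fin m ⊕ Fin m → Fin n × Fin n =>
      collisionTest (ε / 16) (m ^ 2 * τ₀ / 2) (fun i => (b (.inl i)).2)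
        (fun i => (b (.inr (.inl i))).2) (fun i => b (.inr (.inr (.inl i))))
        (fun i => b (.inr (.inr (.inr i))))) r
  refine ⟨fun s t => (D fun i => (s i, t i)).toUnitInterval, fun p q hp hq => ⟨?_, fun hpq => ?_⟩⟩
  · rintro rfl
    have hρ := prodLaw_mem_stdSimplex p.2 p.2
    rw [UnknownTester.acceptProb_eq]
    simp only [Bool.coe_toUnitInterval]
    rw [← iidExp_prodLaw p.1 p.1 fun z => 1 - if D z then (0 : ℝ) else 1, iidExp_sub,
      iidExp_const hρ]
    refine sub_le_sub_left ((hD _ hρ).2 ?_) 1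
    rw [testExp_eq_iidExp_pairs p.2 fun (S : Fin s → Fin n) (A : Fin a → Fin n)
      (z z' : Fin m → Fin n × Fin n) =>
        if collisionTest (ε / 16) (m ^ 2 * τ₀ / 2) S A z z' then 0 else 1]
    linarith [testExp_collisionTest_self_le (s := s) p.2 (ε / 16) hτpos hm]
  · have hρ := prodLaw_mem_stdSimplex p.2 q.2
    rw [UnknownTester.rejectProb_eq]
    simp only [Bool.one_sub_coe_toUnitInterval]
    rw [← iidExp_prodLaw p.1 q.1 fun z => 1 - if D z then (1 : ℝ) else 0, iidExp_sub,
      iidExp_const hρ]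
    refine sub_le_sub_left ((hD _ hρ).1 ?_) 1
    rw [testExp_eq_iidExp_pairs p.2 fun (S : Fin s → Fin n) (A : Fin a → Fin n)
      (z z' : Fin m → Fin n × Fin n) =>
        if collisionTest (ε / 16) (m ^ 2 * τ₀ / 2) S A z z' then 1 else 0]
    linarith [testExp_collisionTest_le hp hq hε hε1 rfl hpq hs hτ₀ hm]

end

/-! ### Sample sizes -/

lemma half_le_log_two : (1 / 2 : ℝ) ≤ Real.log 2 := by linarith [Real.log_two_gt_d9]

lemma log_two_le_mul_log {n k : ℕ} (hn : 2 ≤ n) (hk : 1 ≤ k) :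
    Real.log 2 ≤ k * Real.log n := by
  have h1 : Real.log 2 ≤ Real.log n := Real.log_le_log two_pos (by exact_mod_cast hn)
  have h2 : (1 : ℝ) ≤ k := by exact_mod_cast hk
  have h3 : 0 ≤ Real.log 2 := by linarith [half_le_log_two]
  nlinarith

lemma card_binLabel_le {n k : ℕ} (hn : 2 ≤ n) (hk : 1 ≤ k) {ε : ℝ} (hε : 0 < ε) (hε1 : ε ≤ 1) :
    (Fintype.card (BinLabel n ⌈512 * k / ε⌉₊ (ε / 16)) : ℝ) ≤
      20000 * (k * Real.log n) / ε ^ 2 := by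
  have hk' : (1 : ℝ) ≤ k := by exact_mod_cast hk
  have hL : Real.log 2 ≤ Real.log n := Real.log_le_log two_pos (by exact_mod_cast hn)
  have hL2 := Real.log_two_gt_d9
  set L := Real.log n with hLdef
  have h1 : ((⌈512 * k / ε⌉₊ : ℕ) : ℝ) + 1 ≤ 514 * k / ε := by
    have h := (Nat.ceil_lt_add_one (by positivity : 0 ≤ 512 * (k : ℝ) / ε)).le
    have h' : 1 ≤ (k : ℝ) / ε := by rw [le_div_iff₀ hε]; linarith
    have e : 514 * (k : ℝ) / ε = 512 * k / ε + 2 * (k / ε) := by ring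
    linarith
  have h2 : 2 * ((⌊L / (ε / 16)⌋₊ : ℕ) + 1 : ℝ) + 1 ≤ 37 * L / ε := by
    have h := Nat.floor_le (by have : 0 ≤ L := by linarith
                               positivity : 0 ≤ L / (ε / 16))
    have h' : 3 ≤ 5 * L / ε := by rw [le_div_iff₀ hε]; nlinarith
    have e : 37 * L / ε = 2 * (L / (ε / 16)) + 5 * L / ε := by field_simp; ring
    linarith
  have h3 : (Fintype.card (BinLabel n ⌈512 * k / ε⌉₊ (ε / 16)) : ℝ) =
      ((⌈512 * k / ε⌉₊ : ℕ) + 1) * (2 * ((⌊L / (ε / 16)⌋₊ : ℕ) + 1) + 1) := by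
    simp [BinLabel, hLdef]
  rw [h3]
  have hL0 : 0 ≤ L := by linarith
  calc _ ≤ 514 * k / ε * (37 * L / ε) := by gcongr
    _ = 19018 * (k * L / ε ^ 2) := by field_simp; ring
    _ ≤ 20000 * (k * L / ε ^ 2) := by gcongr; norm_num
    _ = _ := by ring

lemma one_le_card_binLabel (n s : ℕ) (η : ℝ) : (1 : ℝ) ≤ Fintype.card (BinLabel n s η) := by
  exact_mod_cast Fintype.card_pos_iff.2 ⟨((0 : Fin (s + 1)), none)⟩

/-- The constant is `6400 = 4 * 1600`, the `4` coming from `(ε / 2) ^ 2`. -/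
lemma le_ceil_mul_threshold {D ε b : ℝ} (hD : 0 < D) (hε : 0 < ε) (hb : 0 < b) :
    1600 ≤ (⌈6400 * D / (ε ^ 2 * b)⌉₊ : ℕ) * ((ε / 2) ^ 2 / D) * b := by
  have h := Nat.le_ceil (6400 * D / (ε ^ 2 * b))
  have h' : 6400 * D / (ε ^ 2 * b) * ((ε / 2) ^ 2 / D) * b = 1600 := by field_simp; norm_num
  rw [← h']
  gcongr

/-- The logarithmic factor in the sample size cannot make it small. -/
lemma le_three_mul_add_mul_log {Y ε θ E A : ℝ} (hε : 0 < ε) (hε1 : ε ≤ 1) (hY : Real.log 2 ≤ Y)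
    (hθ0 : 0 ≤ θ) (hθ1 : θ ≤ 1) (hE : ε ^ 4 ≤ E) (hA : 1 / ε ^ 4 ≤ A) :
    Y ^ θ / E ≤ 3 * (A + Y ^ θ / E * Real.log (Y / ε)) ∧
      A ≤ 3 * (A + Y ^ θ / E * Real.log (Y / ε)) := by
  have hY0 : 0 < Y := by linarith [half_le_log_two]
  have hE0 : 0 < E := lt_of_lt_of_le (by positivity) hE
  have hA0 : 0 < A := lt_of_lt_of_le (by positivity) hA
  have hEA : 1 / E ≤ A := (one_div_le_one_div_of_le (by positivity) hE).trans hA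
  have hR0 : 0 ≤ Y ^ θ / E := div_nonneg (Real.rpow_nonneg hY0.le _) hE0.le
  have hRA : ∀ c : ℝ, Y ^ θ ≤ c → Y ^ θ / E ≤ c * A := by
    intro c hc
    rw [div_eq_mul_one_div]
    exact mul_le_mul hc hEA (by positivity) ((Real.rpow_nonneg hY0.le _).trans hc)
  -- If the logarithm is at least `1` it only helps. Otherwise `Y < 3`, and the main term is itself
  -- bounded by a multiple of `A`.
  rcases le_or_gt 1 (Real.log (Y / ε)) with h1 | h1
  · have := mul_le_mul_of_nonneg_left h1 hR0
    constructor <;> nlinarith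
  rcases le_or_gt 0 (Real.log (Y / ε)) with h0 | h0
  · have h2 : Y ≤ 3 := by
      have h3 : Y / ε < Real.exp 1 := (Real.log_lt_iff_lt_exp (by positivity)).1 h1
      have h4 : Y ≤ Y / ε := by rw [le_div_iff₀ hε]; nlinarith
      linarith [Real.exp_one_lt_d9]
    have h3 : Y ^ θ ≤ 3 := by
      calc Y ^ θ ≤ 3 ^ θ := Real.rpow_le_rpow hY0.le h2 hθ0
        _ ≤ 3 ^ (1 : ℝ) := Real.rpow_le_rpow_of_exponent_le (by norm_num) hθ1
        _ = 3 := Real.rpow_one 3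
    have h4 := hRA 3 h3
    have h5 := mul_nonneg hR0 h0
    constructor <;> linarith
  · have hYε : Y / ε < 1 := by
      by_contra hc
      exact absurd (Real.log_nonneg (not_lt.1 hc)) (not_le.2 h0)
    have hY1 : Y ≤ 1 := by
      rw [div_lt_one hε] at hYε
      linarith
    have h3 := hRA 1 (Real.rpow_le_one hY0.le hY1 hθ0)
    -- The logarithm may be negative, as for `n = 2`, `k = 1`, `ε = 1`. Because `Y ≥ log 2 > exp (-1
    -- / 2)`, at least half of `A` survives, and the factor `3` restores it.
    have h4 : -(1 / 2) ≤ Real.log (Y / ε) := by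
      have h5 : Real.exp (-(1 / 2)) ≤ Y / ε := by
        have h6 : Real.exp (-(1 / 2)) ≤ 2 / 3 := by
          rw [Real.exp_neg, inv_le_comm₀ (Real.exp_pos _) (by norm_num)]
          have := Real.add_one_le_exp (1 / 2)
          linarith
        have h7 : Y ≤ Y / ε := by rw [le_div_iff₀ hε]; nlinarith
        linarith [Real.log_two_gt_d9]
      exact (Real.le_log_iff_exp_le (by positivity)).2 h5
    have h5 := mul_le_mul_of_nonneg_left h4 hR0
    constructor <;> linarith

/-- The number of repetitions needed for error probability `δ`. -/
lemma exists_repetitions {δ : ℝ} (hδ : 0 < δ) (hδ' : δ < 1 / 2) :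
    ∃ r : ℕ, (2 / 3 : ℝ) ^ r ≤ δ ∧ (r : ℝ) ≤ 5 * Real.log (1 / δ) := by
  have h2 : Real.log 2 ≤ Real.log (1 / δ) := by
    refine Real.log_le_log two_pos ?_
    rw [le_div_iff₀ hδ]
    linarith
  have hl := half_le_log_two
  -- The `3` comes from `2 / 3 ≤ exp (-1 / 3)`; rounding up is absorbed since `log (1 / δ) ≥ 1 / 2`.
  refine ⟨⌈3 * Real.log (1 / δ)⌉₊, ?_, ?_⟩
  · have h := Nat.le_ceil (3 * Real.log (1 / δ))
    set r := ⌈3 * Real.log (1 / δ)⌉₊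
    have h3 : (2 / 3 : ℝ) ≤ Real.exp (-(1 / 3)) := by
      linarith [Real.add_one_le_exp (-(1 / 3) : ℝ)]
    calc (2 / 3 : ℝ) ^ r ≤ Real.exp (-(1 / 3)) ^ r := by gcongr
      _ = Real.exp (r * -(1 / 3)) := (Real.exp_nat_mul _ _).symm
      _ ≤ Real.exp (Real.log δ) := by
        rw [Real.exp_le_exp]
        rw [one_div, Real.log_inv] at h
        linarith
      _ = δ := Real.exp_log hδ
  · have := (Nat.ceil_lt_add_one (by linarith : 0 ≤ 3 * Real.log (1 / δ))).le
    linarith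

/-- For `δ` near `1` the sample bound may fall below one, so no samples may be used; a fair coin
suffices once `δ ≥ 1 / 2`. -/
lemma exists_knownTester_zero (n : ℕ) {δ : ℝ} (hδ : 1 / 2 ≤ δ) :
    ∃ T : KnownTester n 0, ∀ p q : ProbDist n,
      1 - δ ≤ T.acceptProb p q ∧ 1 - δ ≤ T.rejectProb p q := by
  refine ⟨fun _ _ => ⟨1 / 2, by norm_num, by norm_num⟩, fun p q => ?_⟩
  rw [KnownTester.acceptProb_eq, KnownTester.rejectProb_eq, iidExp_const p.2, iidExp_const p.2]
  constructor <;> linarith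

lemma exists_unknownTester_zero (n : ℕ) {δ : ℝ} (hδ : 1 / 2 ≤ δ) :
    ∃ T : UnknownTester n 0, ∀ p q : ProbDist n,
      1 - δ ≤ T.acceptProb p q ∧ 1 - δ ≤ T.rejectProb p q := by
  refine ⟨fun _ _ => ⟨1 / 2, by norm_num, by norm_num⟩, fun p q => ?_⟩
  rw [UnknownTester.acceptProb_eq, UnknownTester.rejectProb_eq, iidExp_const q.2, iidExp_const p.2,
    iidExp_const q.2, iidExp_const p.2]
  constructor <;> linarith

/-- A number of samples per block that suffices when `q` is known. -/
lemma exists_known_blockSize {n k : ℕ} (hn : 2 ≤ n) (hk : 1 ≤ k) {ε : ℝ} (hε : 0 < ε)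
    (hε1 : ε ≤ 1) :
    ∃ s a m : ℕ, 512 * k ≤ (s + 1) * ε ∧
      1600 ≤ m * ((ε / 2) ^ 2 / (Fintype.card (BinLabel n s (ε / 16)) + a)) * √(a + 1) ∧
      ((m + m : ℕ) : ℝ) ≤ 10 ^ 9 * ((k * Real.log n) ^ (1 / 2 : ℝ) / ε ^ 3) := by
  set s := ⌈512 * k / ε⌉₊ with hs
  set N : ℝ := ((Fintype.card (BinLabel n s (ε / 16)) : ℕ) : ℝ) with hN
  set Y : ℝ := k * Real.log n with hY
  have hN1 : 1 ≤ N := one_le_card_binLabel n s _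
  have hNY : N ≤ 20000 * Y / ε ^ 2 := card_binLabel_le hn hk hε hε1
  have hY2 : 1 / 2 ≤ Y := half_le_log_two.trans (log_two_le_mul_log hn hk)
  -- Draws for the weights are free here, so `a = N`; this makes `(N + a) / √(a + 1)` of order `√N`.
  refine ⟨s, Fintype.card (BinLabel n s (ε / 16)),
    ⌈6400 * (N + N) / (ε ^ 2 * √(N + 1))⌉₊, ?_, ?_, ?_⟩
  · have := Nat.le_ceil (512 * k / ε)
    rw [div_le_iff₀ hε] at this
    linarith
  · exact le_ceil_mul_threshold (by positivity) hε (Real.sqrt_pos.2 (by positivity))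
  · rw [← Real.sqrt_eq_rpow]
    have h1 : 6400 * (N + N) / (ε ^ 2 * √(N + 1)) ≤ 12800 * √N / ε ^ 2 := by
      have h2 : √N ≤ √(N + 1) := Real.sqrt_le_sqrt (by linarith)
      have h3 : 0 < √N := Real.sqrt_pos.2 (by linarith)
      calc _ ≤ 6400 * (N + N) / (ε ^ 2 * √N) := by gcongr
        _ = 12800 * (√N * √N) / (ε ^ 2 * √N) := by
          rw [Real.mul_self_sqrt (by linarith)]; ring
        _ = _ := by field_simp
    have h4 : √N ≤ 150 * (√Y / ε) := by
      rw [Real.sqrt_le_left (by positivity), mul_pow, div_pow, Real.sq_sqrt (by linarith)]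
      refine hNY.trans ?_
      rw [mul_div_assoc]
      gcongr
      norm_num
    have h5 : 1 ≤ 2 * (√Y / ε ^ 3) := by
      have h6 : 1 / 2 ≤ √Y := Real.le_sqrt_of_sq_le (by linarith)
      have h7 : ε ^ 3 ≤ 1 := pow_le_one₀ hε.le hε1
      rw [← mul_div_assoc, le_div_iff₀ (by positivity)]
      linarith
    have h6 : 12800 * √N / ε ^ 2 ≤ 12800 * 150 * (√Y / ε ^ 3) := by
      calc _ ≤ 12800 * (150 * (√Y / ε)) / ε ^ 2 := by gcongr
        _ = _ := by field_simp
    have h7 := (Nat.ceil_lt_add_one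
      (by positivity : 0 ≤ 6400 * (N + N) / (ε ^ 2 * √(N + 1)))).le
    push_cast
    linarith

/-- A number of samples per block that suffices when `q` is unknown. -/
lemma exists_unknown_blockSize {n k : ℕ} (hn : 2 ≤ n) (hk : 1 ≤ k) {ε : ℝ} (hε : 0 < ε)
    (hε1 : ε ≤ 1) :
    ∃ s a m : ℕ, 512 * k ≤ (s + 1) * ε ∧
      1600 ≤ m * ((ε / 2) ^ 2 / (Fintype.card (BinLabel n s (ε / 16)) + a)) * √(a + 1) ∧
      ((s + (a + (m + m)) : ℕ) : ℝ) ≤ 514 * ((k : ℝ) ^ 2 / ε ^ 4) +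
        10 ^ 9 * ((k * Real.log n) ^ (2 / 3 : ℝ) / ε ^ (10 / 3 : ℝ)) := by
  set s := ⌈512 * k / ε⌉₊ with hs
  set N : ℝ := ((Fintype.card (BinLabel n s (ε / 16)) : ℕ) : ℝ) with hN
  set Y : ℝ := k * Real.log n with hY
  have hN1 : 1 ≤ N := one_le_card_binLabel n s _
  have hN0 : 0 < N := by linarith
  have hNY : N ≤ 20000 * Y / ε ^ 2 := card_binLabel_le hn hk hε hε1
  have hY2 : 1 / 2 ≤ Y := half_le_log_two.trans (log_two_le_mul_log hn hk)
  have hY0 : 0 < Y := by linarith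
  have hk' : (1 : ℝ) ≤ k := by exact_mod_cast hk
  -- Here the weight draws are charged. With `a` about `N ^ (2 / 3)`, both `a` and `N / √a` have
  -- order `N ^ (2 / 3)`.
  set V := N ^ (2 / 3 : ℝ) with hV
  have hV1 : 1 ≤ V := Real.one_le_rpow hN1 (by norm_num)
  have hVN : V ≤ N := by
    calc V ≤ N ^ (1 : ℝ) := Real.rpow_le_rpow_of_exponent_le hN1 (by norm_num)
      _ = N := Real.rpow_one N
  set a := ⌈V⌉₊ with ha
  have haV : V ≤ a := Nat.le_ceil V
  have haV' : (a : ℝ) ≤ V + 1 := (Nat.ceil_lt_add_one (by linarith)).le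
  set W := N ^ (1 / 3 : ℝ) with hW
  have hW0 : 0 < W := Real.rpow_pos_of_pos hN0 _
  have hWV : V * W = N := by
    rw [hV, hW, ← Real.rpow_add hN0]; norm_num
  have hWW : W ^ 2 = V := by
    rw [hV, hW, ← Real.rpow_natCast, ← Real.rpow_mul hN0.le]; norm_num
  have hWa : W ≤ √(a + 1) := Real.le_sqrt_of_sq_le (by linarith)
  refine ⟨s, a, ⌈6400 * (N + a) / (ε ^ 2 * √(a + 1))⌉₊, ?_, ?_, ?_⟩
  · have := Nat.le_ceil (512 * k / ε)
    rw [div_le_iff₀ hε] at this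
    linarith
  · exact le_ceil_mul_threshold (by positivity) hε (Real.sqrt_pos.2 (by positivity))
  · have h1 : 6400 * (N + a) / (ε ^ 2 * √(a + 1)) ≤ 19200 * (V / ε ^ 2) := by
      calc _ ≤ 6400 * (N + (N + N)) / (ε ^ 2 * W) := by gcongr; linarith
        _ = 19200 * (V * W) / (ε ^ 2 * W) := by rw [hWV]; ring
        _ = _ := by field_simp
    have h2 : V / ε ^ 2 ≤ 20000 * (Y ^ (2 / 3 : ℝ) / ε ^ (10 / 3 : ℝ)) := by
      have h3 : V ≤ 20000 * (Y ^ (2 / 3 : ℝ) / ε ^ (4 / 3 : ℝ)) := by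
        calc V ≤ (20000 * Y / ε ^ 2) ^ (2 / 3 : ℝ) :=
              Real.rpow_le_rpow hN0.le hNY (by norm_num)
          _ = 20000 ^ (2 / 3 : ℝ) * (Y ^ (2 / 3 : ℝ) / ε ^ (4 / 3 : ℝ)) := by
              rw [Real.div_rpow (by positivity) (by positivity),
                Real.mul_rpow (by norm_num) hY0.le, ← Real.rpow_natCast ε 2,
                ← Real.rpow_mul hε.le, mul_div_assoc]
              norm_num
          _ ≤ 20000 ^ (1 : ℝ) * (Y ^ (2 / 3 : ℝ) / ε ^ (4 / 3 : ℝ)) := by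
              gcongr <;> norm_num
          _ = _ := by rw [Real.rpow_one]
      have h4 : ε ^ (10 / 3 : ℝ) = ε ^ (4 / 3 : ℝ) * ε ^ 2 := by
        rw [← Real.rpow_natCast ε 2, ← Real.rpow_add hε]; norm_num
      rw [h4]
      calc V / ε ^ 2 ≤ 20000 * (Y ^ (2 / 3 : ℝ) / ε ^ (4 / 3 : ℝ)) / ε ^ 2 := by gcongr
        _ = _ := by field_simp
    have hε2 : ε ^ 2 ≤ 1 := pow_le_one₀ hε.le hε1
    have h5 : V ≤ V / ε ^ 2 := by
      rw [le_div_iff₀ (by positivity)]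
      exact mul_le_of_le_one_right (by linarith) hε2
    have h6 := (Nat.ceil_lt_add_one
      (by positivity : 0 ≤ 6400 * (N + a) / (ε ^ 2 * √(a + 1)))).le
    have h7 : (s : ℝ) ≤ 514 * (k ^ 2 / ε ^ 4) := by
      have h8 := (Nat.ceil_lt_add_one (by positivity : 0 ≤ 512 * (k : ℝ) / ε)).le
      have h9 : (k : ℝ) / ε ≤ k ^ 2 / ε ^ 4 := by
        have h10 : (k : ℝ) ≤ k ^ 2 := le_self_pow₀ hk' two_ne_zero
        have h11 : ε ^ 4 ≤ ε := pow_le_of_le_one hε.le hε1 (by norm_num)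
        gcongr
      have h12 : 1 ≤ (k : ℝ) / ε := by rw [le_div_iff₀ hε]; linarith
      have e : 512 * (k : ℝ) / ε = 512 * (k / ε) := by ring
      linarith
    push_cast
    linarith

theorem mainTheorem2 :
    (∃ C : ℝ, 0 < C ∧ ∀ (n k : ℕ) (ε δ : ℝ),
      2 ≤ n → 1 ≤ k → 0 < ε → ε ≤ 1 → 0 < δ → δ < 1 →
      ∃ m : ℕ,
        (m : ℝ) ≤ C * ((k : ℝ) ^ 2 / ε ^ 4
          + ((k : ℝ) * Real.log n) ^ (1 / 2 : ℝ) / ε ^ 3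
            * Real.log ((k : ℝ) * Real.log n / ε)) * Real.log (1 / δ) ∧
        ∃ T : KnownTester n m, ∀ p q : ProbDist n, IsKModal k p → IsKModal k q →
          (p = q → 1 - δ ≤ T.acceptProb p q) ∧
          (ε ≤ tvDist p q → 1 - δ ≤ T.rejectProb p q)) ∧
    (∃ C : ℝ, 0 < C ∧ ∀ (n k : ℕ) (ε δ : ℝ),
      2 ≤ n → 1 ≤ k → 0 < ε → ε ≤ 1 → 0 < δ → δ < 1 →
      ∃ m : ℕ,
        (m : ℝ) ≤ C * ((k : ℝ) ^ 2 / ε ^ 4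
          + ((k : ℝ) * Real.log n) ^ (2 / 3 : ℝ) / ε ^ (10 / 3 : ℝ)
            * Real.log ((k : ℝ) * Real.log n / ε)) * Real.log (1 / δ) ∧
        ∃ T : UnknownTester n m, ∀ p q : ProbDist n, IsKModal k p → IsKModal k q →
          (p = q → 1 - δ ≤ T.acceptProb p q) ∧
          (ε ≤ tvDist p q → 1 - δ ≤ T.rejectProb p q)) := by
  have hA : ∀ {k : ℕ} {ε : ℝ}, 1 ≤ k → 0 < ε → 1 / ε ^ 4 ≤ (k : ℝ) ^ 2 / ε ^ 4 := by
    intro k ε hk hε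
    have : (1 : ℝ) ≤ k := by exact_mod_cast hk
    gcongr
    exact one_le_pow₀ this
  constructor
  -- The product of `5` from the repetitions, `10 ^ 9` from the block size and `3` from the
  -- logarithmic factor.
  · refine ⟨15 * 10 ^ 9, by norm_num, fun n k ε δ hn hk hε hε1 hδ hδ1 => ?_⟩
    have hlog : 0 < Real.log (1 / δ) := Real.log_pos (by rw [lt_div_iff₀ hδ]; linarith)
    obtain ⟨hR, hA'⟩ := le_three_mul_add_mul_log (θ := 1 / 2) (E := ε ^ 3) hε hε1
      (log_two_le_mul_log hn hk) (by norm_num) (by norm_num)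
      (pow_le_pow_of_le_one hε.le hε1 (by norm_num)) (hA hk hε)
    set Z := (k : ℝ) ^ 2 / ε ^ 4 + ((k : ℝ) * Real.log n) ^ (1 / 2 : ℝ) / ε ^ 3
      * Real.log ((k : ℝ) * Real.log n / ε) with hZ
    have hZ0 : 0 ≤ Z := by
      have : 0 ≤ (k : ℝ) ^ 2 / ε ^ 4 := by positivity
      linarith
    rcases le_or_gt (1 / 2) δ with h | h
    · obtain ⟨T, hT⟩ := exists_knownTester_zero n h
      exact ⟨0, by rw [Nat.cast_zero]; positivity, T, fun p q _ _ =>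
        ⟨fun _ => (hT p q).1, fun _ => (hT p q).2⟩⟩
    · obtain ⟨r, hr, hr'⟩ := exists_repetitions hδ h
      obtain ⟨s, a, m, hs, hm, hcard⟩ := exists_known_blockSize hn hk hε hε1
      obtain ⟨T, hT⟩ := exists_knownTester n k s a m r hε hε1 hs rfl hm
      refine ⟨_, ?_, T, fun p q hp hq => ⟨fun hpq => ?_, fun hpq => ?_⟩⟩
      · rw [Fintype.card_sum, Fintype.card_fin, Nat.cast_mul]
        calc (r : ℝ) * ((m + m : ℕ) : ℝ) ≤ 5 * Real.log (1 / δ) * (10 ^ 9 * (3 * Z)) := by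
              gcongr
              linarith
          _ = _ := by ring
      · linarith [(hT p q hp hq).1 hpq]
      · linarith [(hT p q hp hq).2 hpq]
  -- As in the known case, but the block size is at most `2 * 10 ^ 9 * (3 * Z)`, since it also
  -- contains the term `514 * (k ^ 2 / ε ^ 4)`.
  · refine ⟨30 * 10 ^ 9, by norm_num, fun n k ε δ hn hk hε hε1 hδ hδ1 => ?_⟩
    have hlog : 0 < Real.log (1 / δ) := Real.log_pos (by rw [lt_div_iff₀ hδ]; linarith)
    obtain ⟨hR, hA'⟩ := le_three_mul_add_mul_log (θ := 2 / 3) (E := ε ^ (10 / 3 : ℝ)) hε hε1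
      (log_two_le_mul_log hn hk) (by norm_num) (by norm_num)
      (by
        rw [← Real.rpow_natCast]
        exact Real.rpow_le_rpow_of_exponent_ge hε hε1 (by norm_num)) (hA hk hε)
    set Z := (k : ℝ) ^ 2 / ε ^ 4 + ((k : ℝ) * Real.log n) ^ (2 / 3 : ℝ) / ε ^ (10 / 3 : ℝ)
      * Real.log ((k : ℝ) * Real.log n / ε) with hZ
    have hZ0 : 0 ≤ Z := by
      have : 0 ≤ (k : ℝ) ^ 2 / ε ^ 4 := by positivity
      linarith
    rcases le_or_gt (1 / 2) δ with h | h
    · obtain ⟨T, hT⟩ := exists_unknownTester_zero n h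
      exact ⟨0, by rw [Nat.cast_zero]; positivity, T, fun p q _ _ =>
        ⟨fun _ => (hT p q).1, fun _ => (hT p q).2⟩⟩
    · obtain ⟨r, hr, hr'⟩ := exists_repetitions hδ h
      obtain ⟨s, a, m, hs, hm, hcard⟩ := exists_unknown_blockSize hn hk hε hε1
      obtain ⟨T, hT⟩ := exists_unknownTester n k s a m r hε hε1 hs rfl hm
      refine ⟨_, ?_, T, fun p q hp hq => ⟨fun hpq => ?_, fun hpq => ?_⟩⟩
      · simp only [Fintype.card_sum, Fintype.card_fin]
        rw [Nat.cast_mul]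
        calc (r : ℝ) * ((s + (a + (m + m)) : ℕ) : ℝ) ≤
              5 * Real.log (1 / δ) * (2 * 10 ^ 9 * (3 * Z)) := by
              gcongr
              linarith
          _ = _ := by ring
      · linarith [(hT p q hp hq).1 hpq]
      · linarith [(hT p q hp hq).2 hpq]
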